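/- Let $N\ge 3$, let $\mu_N$ be the group of $N$-th roots of unity, $\zeta_N\in\mu_N$ a primitive one, $K=\mathbb{Q}(\mu_N)$ and $G_N=\mathrm{Gal}(K/\mathbb{Q})$. For $\alpha\in\mathbb{Z}/N$ the power $\zeta_N^{\alpha}$ is well defined. For an alphabet $A$ and a ring $R$, let $R\langle\langle A\rangle\rangle$ be the algebra of noncommutative power series and $(\psi\mid w)$ the coefficient of the word $w$ in $\psi$; $\hat\otimes$ is the tensor product completed for the filtration by word length, so that for a $\mathbb{Q}$-subspace $V\subset \mathbb{Q}\langle\langle A\rangle\rangle$, $K\hat\otimes V\subset K\langle\langle A\rangle\rangle$ is the closure of the $K$-span of $V$. All algebra morphisms and derivations below are continuous, hence determined by the images of the letters. **Roots of unity.** Let $X=\{x_0\}\cup\{x_\zeta\}_{\zeta\in\mu_N}$, $Y=\{y_{k,\zeta}\}_{k\ge1,\zeta\in\mu_N}$, with $\mathbb{Q}\langle\langle Y\rangle\rangle\subset\mathbb{Q}\langle\langle X\rangle\rangle$ via $y_{k,\zeta}=x_0^{k-1}x_\zeta$, and let $\pi_Y$ be the projection of $\mathbb{Q}\langle\langle X\rangle\rangle=\mathbb{Q}\langle\langle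 Y\rangle\rangle\oplus\mathbb{Q}\langle\langle X\rangle\rangle x_0$ onto the first summand. Let $\mathbf p$ be the linear automorphism $x_0^{k_1-1}x_{\zeta_1}x_0^{k_2-1}x_{\zeta_2}\cdots x_0^{k_r-1}x_{\zeta_r}x_0^{k_{r+1}-1}\mapsto x_0^{k_1-1}x_{\zeta_1}x_0^{k_2-1}x_{\zeta_1\zeta_2}\cdots x_0^{k_r-1}x_{\zeta_1\cdots\zeta_r}x_0^{k_{r+1}-1}$. Let $\Delta_{\mathrm{sh}}$ be the algebra morphism on $\mathbb{Q}\langle\langle X\rangle\rangle$ for which all letters are primitive, and $\Delta_*$ the algebra morphism on $\mathbb{Q}\langle\langle Y\rangle\rangle$ with $y_{k,\zeta}\mapsto y_{k,\zeta}\otimes1+1\otimes y_{k,\zeta}+\sum_{k_1+k_2=k,\ \zeta_1\zeta_2=\zeta}y_{k_1,\zeta_1}\otimes y_{k_2,\zeta_2}$. Then $\mathfrak{dmr}_0^{\mu_N}$ is the set of $\psi\in\mathbb{Q}\langle\langle X\rangle\rangle$ such that $(\psi\mid x_0)=(\psi\mid x_1)=0$; $\psi$ is primitive for $\Delta_{\mathrm{sh}}$;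 $(\psi\mid x_\zeta-x_{\zeta^{-1}})=0$ for all $\zeta\in\mu_N$; and $$\psi_*=\pi_Y(\mathbf p^{-1}\psi)+\sum_{n\ge2}\tfrac{(-1)^{n-1}}{n}(\psi\mid x_0^{n-1}x_1)\,y_{1,1}^n$$ is primitive for $\Delta_*$. Let $t_\zeta$ be the algebra automorphism $x_0\mapsto x_0$, $x_\eta\mapsto x_{\zeta\eta}$, let $d_\psi$ be the derivation $x_0\mapsto0$, $x_\zeta\mapsto[x_\zeta,t_\zeta(\psi)]$, and set $\langle\psi_1,\psi_2\rangle=d_{\psi_1}(\psi_2)-d_{\psi_2}(\psi_1)+[\psi_1,\psi_2]$, over $\mathbb{Q}$ and over $K$. **Congruence classes.** Let $\widetilde X=\{\tilde x\}\cup\{\tilde x_\alpha\}_{\alpha\in\mathbb{Z}/N}$, $\widetilde Y=\{\tilde y_{k,\alpha}\}_{k\ge1,\alpha\in\mathbb{Z}/N}$, $\tilde y_{k,\alpha}=\tilde x^{k-1}\tilde x_\alpha$, and define $\pi_{\widetilde Y}$ and $\Delta_{\widetilde{\mathrm{sh}}}$ as above. Let $\widetilde{\mathbf q}$ be the linear automorphism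 $\tilde x^{k_1-1}\tilde x_{\alpha_1}\cdots\tilde x^{k_{r-1}-1}\tilde x_{\alpha_{r-1}}\tilde x^{k_r-1}\tilde x_{\alpha_r}\tilde x^{k_{r+1}-1}\mapsto\tilde x^{k_1-1}\tilde x_{\alpha_1-\alpha_2}\cdots\tilde x^{k_{r-1}-1}\tilde x_{\alpha_{r-1}-\alpha_r}\tilde x^{k_r-1}\tilde x_{\alpha_r}\tilde x^{k_{r+1}-1}$ and $\Delta_{\tilde *}$ the algebra morphism with $\tilde y_{k,\alpha}\mapsto\tilde y_{k,\alpha}\otimes1+1\otimes\tilde y_{k,\alpha}+\sum_{k_1+k_2=k}\tilde y_{k_1,\alpha}\otimes\tilde y_{k_2,\alpha}$. Then $\mathfrak{dmr}_0^{[N]}$ is the set of $\tilde\psi\in\mathbb{Q}\langle\langle\widetilde X\rangle\rangle$ such that $(\tilde\psi\mid\tilde x)=\sum_\alpha(\tilde\psi\mid\tilde x_\alpha)=0$; $\tilde\psi$ is primitive for $\Delta_{\widetilde{\mathrm{sh}}}$; $(\tilde\psi\mid\tilde x_\alpha-\tilde x_{-\alpha})=0$ for all $\alpha$; and $$\tilde\psi_{\tilde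 *}=\pi_{\widetilde Y}(\widetilde{\mathbf q}^{-1}\tilde\psi)+\sum_{n\ge2}\ \sum_{\alpha,\beta_1,\dots,\beta_n\in\mathbb{Z}/N}\tfrac{(-1)^{n-1}}{n\,N^{n}}(\tilde\psi\mid\tilde x^{n-1}\tilde x_\alpha)\,\tilde y_{1,\beta_1}\cdots\tilde y_{1,\beta_n}$$ is primitive for $\Delta_{\tilde *}$. Over $K$ let $\tilde t_m$ be the algebra automorphism $\tilde x\mapsto\tilde x$, $\tilde x_\alpha\mapsto\zeta_N^{m\alpha}\tilde x_\alpha$, let $\widetilde T_\alpha=\frac1N\sum_{m\in\mathbb{Z}/N}\zeta_N^{-m\alpha}\tilde t_m$, let $\tilde d_\psi$ be the derivation $\tilde x\mapsto0$, $\tilde x_\alpha\mapsto\widetilde T_\alpha([\sum_\beta\tilde x_\beta,\psi])$, and set $\langle\psi_1,\psi_2\rangle^{\sim}=\tilde d_{\psi_1}(\psi_2)-\tilde d_{\psi_2}(\psi_1)+[\psi_1,\psi_2]$. **Comparison and actions.** Let $\mathcal F:K\langle\langle\widetilde X\rangle\rangle\to K\langle\langle X\rangle\rangle$ be the $K$-algebra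 morphism with $\tilde x\mapsto x_0$, $\tilde x_\alpha\mapsto\sum_{m\in\mathbb{Z}/N}\zeta_N^{-m\alpha}x_{\zeta_N^m}$. For $\sigma\in G_N$ let $\gamma\in(\mathbb{Z}/N)^\times$ be such that $\sigma(\zeta_N)=\zeta_N^\gamma$. Let $\Delta_\sigma$ act on $K\langle\langle X\rangle\rangle$ by $\sigma$ on the coefficients and $x_0\mapsto x_0$, $x_\zeta\mapsto x_{\zeta^\gamma}$ on the letters, and let $\widetilde\Delta_\sigma$ act on $K\langle\langle\widetilde X\rangle\rangle$ by $\sigma$ on the coefficients and $\tilde x\mapsto\tilde x$, $\tilde x_\alpha\mapsto\tilde x_{\gamma\alpha}$ on the letters. **Theorem (Galois descent).** The map $\mathcal F$ restricts to $\mathbb{Q}$-linear isomorphisms $$\bigl(K\hat\otimes_{\mathbb{Q}}\mathfrak{dmr}_0^{[N]}\bigr)^{\widetilde\Delta_{G_N}}\ \simeq\ \mathfrak{dmr}_0^{\mu_N}\qquad\text{and}\qquad \mathfrak{dmr}_0^{[N]}\ \simeq\ \bigl(K\hat\otimes_{\mathbb{Q}}\mathfrak{dmr}_0^{\mu_N}\bigr)^{\Delta_{G_N}},$$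 where $\mathbb{Q}\langle\langle X\rangle\rangle$ and $\mathbb{Q}\langle\langle\widetilde X\rangle\rangle$ are regarded as subspaces of $K\langle\langle X\rangle\rangle$ and $K\langle\langle\widetilde X\rangle\rangle$. Both isomorphisms carry $\langle\cdot,\cdot\rangle^{\sim}$ to $\langle\cdot,\cdot\rangle$; the bracket $\langle\cdot,\cdot\rangle^{\sim}$ of two elements of $\mathfrak{dmr}_0^{[N]}$ has rational coefficients. -/

import Mathlib

/-!  Noncommutative formal power series, the two double shuffle Lie algebras attached to
`N`-th roots of unity and to congruence classes modulo `N`, and the Galois actions on them. -/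

noncomputable section

namespace DoubleShuffle

open Finset

/-! ### Formal power series in noncommuting letters -/

/-- `R⟨⟨A⟩⟩`: a series is the family of its coefficients `(ψ ∣ w)`, indexed by the words `w` in the
alphabet `A`.  Likewise an element of the completed tensor square `R⟨⟨A⟩⟩ ⊗̂ R⟨⟨A⟩⟩` is the family of
its coefficients at `u ⊗ v`, a function on `FreeMonoid A × FreeMonoid A`. -/
abbrev Series (R A : Type*) := FreeMonoid A → R

section General

variable {R A M : Type*}

open scoped Classical in
/-- The letter `a`, as a series. -/
def letter (R : Type*) [CommRing R] (a : A) : Series R A := Pi.single (FreeMonoid.of a) 1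

open scoped Classical in
/-- The series `1`. -/
def one (R A : Type*) [CommRing R] : Series R A := Pi.single 1 1

/-- The (concatenation) product of series: the coefficient at `w` is the sum over all ways to cut
`w` in two. -/
def mul [CommRing R] (f g : Series R A) : Series R A := fun w =>
  ∑ i ∈ range (w.length + 1),
    f (FreeMonoid.ofList (w.toList.take i)) * g (FreeMonoid.ofList (w.toList.drop i))

/-- The commutator of series. -/
def comm [CommRing R] (f g : Series R A) : Series R A := mul f g - mul g f

/-- The continuous derivation of `R⟨⟨A⟩⟩` (finite alphabet `A`) that sends each letter `a` to `D a`.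
On a word, `d (p a s)` contains the term `p (D a) s` for each of its letters `a`; hence the
coefficient at `w` collects all factorizations `w = p m s` and all letters `a`. -/
def derivation [CommRing R] [Fintype A] (D : A → Series R A) (f : Series R A) : Series R A :=
  fun w => ∑ i ∈ range (w.length + 1), ∑ j ∈ Icc i w.length, ∑ a : A,
    f (FreeMonoid.ofList (w.toList.take i ++ a :: w.toList.drop j)) *
      D a (FreeMonoid.ofList ((w.toList.drop i).take (j - i)))

/-- `f ⊗ g` in the completed tensor square. -/
def tensor [CommRing R] (f g : Series R A) : FreeMonoid A × FreeMonoid A → R :=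
  fun p => f p.1 * g p.2

/-- The linear map `f ↦ f ⊗ 1 + 1 ⊗ f`. -/
def primitivePart (R A : Type*) [CommRing R] :
    Series R A →ₗ[R] (FreeMonoid A × FreeMonoid A → R) where
  toFun f := tensor f (one R A) + tensor (one R A) f
  map_add' f g := by ext p; simp only [tensor, Pi.add_apply]; ring
  map_smul' c f := by
    ext p; simp only [tensor, Pi.add_apply, Pi.smul_apply, smul_eq_mul, RingHom.id_apply]; ring

/-- A family `φ` of polynomials (finite sums of elements of a monoid `M`), indexed by letters, is
locally finite if each `m : M` occurs in the image of finitely many words only. -/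
def LocallyFinite [CommRing R] [Monoid M] (φ : A → MonoidAlgebra R M) : Prop :=
  ∀ m : M, {w : FreeMonoid A | (FreeMonoid.lift φ w).coeff m ≠ 0}.Finite

/-- The continuous algebra morphism from `R⟨⟨A⟩⟩` to the series on the monoid `M`, that
sends each letter `a` to `φ a`: it maps `∑ (ψ ∣ w) w` to `∑ (ψ ∣ w) φ(w)`.  It is used for
`M = FreeMonoid B` (target `R⟨⟨B⟩⟩`) and `M = FreeMonoid A × FreeMonoid A` (target the completed
tensor square of `R⟨⟨A⟩⟩`). -/
def extend [CommRing R] [Monoid M] (φ : A → MonoidAlgebra R M) (hφ : LocallyFinite φ) :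
    Series R A →ₗ[R] (M → R) where
  toFun ψ m := ∑ᶠ w : FreeMonoid A, ψ w * (FreeMonoid.lift φ w).coeff m
  map_add' f g := by
    have key : ∀ (h : Series R A) (m : M),
        (Function.support fun w => h w * (FreeMonoid.lift φ w).coeff m).Finite := fun h m =>
      (hφ m).subset fun w hw => right_ne_zero_of_mul hw
    ext m
    simp only [Pi.add_apply, add_mul]
    exact finsum_add_distrib (key f m) (key g m)
  map_smul' c f := by
    have key : ∀ (h : Series R A) (m : M),
        (Function.support fun w => h w * (FreeMonoid.lift φ w).coeff m).Finite := fun h m =>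
      (hφ m).subset fun w hw => right_ne_zero_of_mul hw
    ext m
    simp only [Pi.smul_apply, smul_eq_mul, RingHom.id_apply, mul_assoc]
    exact (mul_finsum' _ _ (key f m)).symm

theorem finite_words (a : A → ℕ) (pos : ∀ x, 1 ≤ a x) (fin : ∀ n, {x | a x = n}.Finite) (n : ℕ) :
    {w : List A | (w.map a).sum = n}.Finite := by
  induction n using Nat.strong_induction_on with
  | _ n ih =>
    have h : {w : List A | (w.map a).sum = n} ⊆ {[]} ∪ ⋃ k ∈ Set.Icc 1 n,
        Set.image2 List.cons {x | a x = k} {w : List A | (w.map a).sum = n - k} := by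
      intro w hw
      cases w with
      | nil => simp
      | cons x w =>
        have hx := pos x
        simp only [Set.mem_ofPred_eq, List.map_cons, List.sum_cons] at hw
        refine Or.inr (Set.mem_biUnion (x := a x) ⟨hx, by omega⟩ ⟨x, rfl, w, ?_, rfl⟩)
        simp only [Set.mem_ofPred_eq]; omega
    refine Set.Finite.subset (Set.Finite.union (Set.finite_singleton _)
      (Set.Finite.biUnion (Set.finite_Icc 1 n) fun k hk => ?_)) h
    have h1 : 1 ≤ k := hk.1
    have h2 : k ≤ n := hk.2
    exact Set.Finite.image2 _ (fin k) (ih (n - k) (by omega))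

theorem locallyFinite_of_weight [CommRing R] [Monoid M] (φ : A → MonoidAlgebra R M)
    (a : A → ℕ) (pos : ∀ x, 1 ≤ a x) (fin : ∀ n, {x | a x = n}.Finite)
    (b : M → ℕ) (b_one : b 1 = 0) (b_mul : ∀ x y, b (x * y) = b x + b y)
    (h : ∀ x m, (φ x).coeff m ≠ 0 → b m = a x) : LocallyFinite φ := by
  have key : ∀ (w : List A) (m : M),
      (FreeMonoid.lift φ (FreeMonoid.ofList w)).coeff m ≠ 0 → b m = (w.map a).sum := by
    classical
    intro w
    induction w with
    | nil =>
      intro m hm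
      by_cases hm1 : m = 1
      · subst hm1; simpa using b_one
      · exfalso; apply hm
        simp [MonoidAlgebra.one_def, Ne.symm hm1]
    | cons x w ih =>
      intro m hm
      rw [FreeMonoid.ofList_cons, map_mul, FreeMonoid.lift_eval_of] at hm
      obtain ⟨y, hy, z, hz, rfl⟩ := Finset.mem_mul.1
        (MonoidAlgebra.support_coeff_mul_subset _ _ (Finsupp.mem_support_iff.2 hm))
      rw [b_mul, h x y (Finsupp.mem_support_iff.1 hy), ih z (Finsupp.mem_support_iff.1 hz)]
      simp
  intro m
  exact (finite_words a pos fin (b m)).subset fun w hw => (key w m hw).symm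

/-- The polynomial consisting of the word (or tensor of words) `m`. -/
def mono (R : Type*) [CommRing R] (m : M) : MonoidAlgebra R M := MonoidAlgebra.single m 1

/-- The image of a letter under a linear substitution `a ↦ ∑ b, c a b • b` of letters. -/
def linearLetter {B : Type*} [CommRing R] [Fintype B] (c : A → B → R) (a : A) :
    MonoidAlgebra R (FreeMonoid B) := ∑ b, c a b • mono R (FreeMonoid.of b)

theorem coeff_mono_ne_zero [CommRing R] {m m' : M} (h : (mono R m).coeff m' ≠ 0) : m' = m := by
  classical
  by_contra hne
  exact h (by simp [mono, Ne.symm hne])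

theorem locallyFinite_linearLetter {B : Type*} [CommRing R] [Fintype B] [Finite A]
    (c : A → B → R) : LocallyFinite (linearLetter c) := by
  refine locallyFinite_of_weight _ (fun _ => 1) (fun _ => le_rfl) (fun _ => Set.toFinite _)
    FreeMonoid.length FreeMonoid.length_one FreeMonoid.length_mul fun x m hm => ?_
  rw [linearLetter, MonoidAlgebra.coeff_sum, Finsupp.finsetSum_apply] at hm
  obtain ⟨b, -, hb⟩ := Finset.exists_ne_zero_of_sum_ne_zero hm
  rw [MonoidAlgebra.coeff_smul, Finsupp.smul_apply] at hb
  rw [coeff_mono_ne_zero (right_ne_zero_of_mul hb)]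
  rfl

/-- The continuous algebra morphism `R⟨⟨A⟩⟩ → R⟨⟨B⟩⟩` given by `a ↦ ∑ b, c a b • b`. -/
def substitute {B : Type*} [CommRing R] [Fintype B] [Finite A] (c : A → B → R) :
    Series R A →ₗ[R] Series R B := extend (linearLetter c) (locallyFinite_linearLetter c)

open scoped Classical in
/-- The continuous algebra morphism given by a map `a ↦ s a` on letters. -/
def rename {B : Type*} (R : Type*) [CommRing R] [Fintype B] [Finite A] (s : A → B) :
    Series R A →ₗ[R] Series R B := substitute fun a b => if s a = b then 1 else 0

/-- The image of a letter `a` under the shuffle coproduct, `a ⊗ 1 + 1 ⊗ a`. -/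
def shuffleLetter (R : Type*) [CommRing R] (a : A) :
    MonoidAlgebra R (FreeMonoid A × FreeMonoid A) :=
  mono R (FreeMonoid.of a, 1) + mono R (1, FreeMonoid.of a)

theorem locallyFinite_shuffleLetter (R : Type*) [CommRing R] [Finite A] :
    LocallyFinite (shuffleLetter R : A → _) := by
  refine locallyFinite_of_weight _ (fun _ => 1) (fun _ => le_rfl) (fun _ => Set.toFinite _)
    (fun p => p.1.length + p.2.length) (by simp)
    (fun x y => by simp only [Prod.fst_mul, Prod.snd_mul, FreeMonoid.length_mul]; ring)
    fun x m hm => ?_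
  rw [shuffleLetter, MonoidAlgebra.coeff_add, Finsupp.add_apply] at hm
  by_cases h : (mono R ((FreeMonoid.of x, 1) : FreeMonoid A × FreeMonoid A)).coeff m = 0
  · rw [h, zero_add] at hm
    rw [coeff_mono_ne_zero hm]; simp
  · rw [coeff_mono_ne_zero h]; simp

/-- The shuffle coproduct `R⟨⟨A⟩⟩ → R⟨⟨A⟩⟩ ⊗̂ R⟨⟨A⟩⟩`, the continuous algebra morphism with
`a ↦ a ⊗ 1 + 1 ⊗ a`. -/
def shuffleCoproduct (R A : Type*) [CommRing R] [Finite A] :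
    Series R A →ₗ[R] (FreeMonoid A × FreeMonoid A → R) :=
  extend (shuffleLetter R) (locallyFinite_shuffleLetter R)

/-- Extension of coefficients `ℚ⟨⟨A⟩⟩ ⊆ K⟨⟨A⟩⟩`. -/
def baseChange (K A : Type*) [Field K] [Algebra ℚ K] : Series ℚ A →ₗ[ℚ] Series K A where
  toFun ψ w := algebraMap ℚ K (ψ w)
  map_add' f g := funext fun _ => map_add _ _ _
  map_smul' c f := funext fun w => by
    simp only [Pi.smul_apply, smul_eq_mul, map_mul, RingHom.id_apply, Algebra.smul_def]

/-- `K ⊗̂_ℚ V ⊆ K⟨⟨A⟩⟩` for a `ℚ`-subspace `V` of `ℚ⟨⟨A⟩⟩`: the closure, for the topology of the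
filtration by word length, of the `K`-span of `V`. -/
def completedTensor (K : Type*) {A : Type*} [Field K] [Algebra ℚ K]
    (V : Submodule ℚ (Series ℚ A)) : Submodule K (Series K A) where
  carrier := {f | ∀ n : ℕ, ∃ g ∈ Submodule.span K (baseChange K A '' V),
    ∀ w : FreeMonoid A, w.length ≤ n → f w = g w}
  add_mem' := by
    intro f f' hf hf' n
    obtain ⟨g, hg, h⟩ := hf n
    obtain ⟨g', hg', h'⟩ := hf' n
    exact ⟨g + g', add_mem hg hg', fun w hw => by simp [h w hw, h' w hw]⟩
  zero_mem' := fun n => ⟨0, zero_mem _, fun _ _ => rfl⟩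
  smul_mem' := by
    intro c f hf n
    obtain ⟨g, hg, h⟩ := hf n
    exact ⟨c • g, Submodule.smul_mem _ c hg, fun w hw => by simp [h w hw]⟩

end General

/-! ### The alphabets `X` and `Y` -/

/-- The alphabet `{x₀} ∪ {x_i ∣ i ∈ I}`: `none` is `x₀` and `some i` is `x_i`.  The alphabet `X` is
`XLetter μ_N` and the alphabet `X̃` is `XLetter (ZMod N)`. -/
abbrev XLetter (I : Type*) := Option I

/-- The alphabet of the letters `y_{k,i}` with `k ≥ 1` and `i ∈ I`. -/
abbrev YLetter (I : Type*) := ℕ+ × I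

section Alphabets

variable {I : Type*}

/-- The word `x₀ⁿ x_i`. -/
def zeroPowThen (n : ℕ) (i : I) : FreeMonoid (XLetter I) :=
  FreeMonoid.of none ^ n * FreeMonoid.of (some i)

/-- The embedding of words given by `y_{k,i} ↦ x₀^{k-1} x_i`. -/
def yToX : FreeMonoid (YLetter I) →* FreeMonoid (XLetter I) :=
  FreeMonoid.lift fun y => zeroPowThen ((y.1 : ℕ) - 1) y.2

/-- The projection `π_Y : R⟨⟨X⟩⟩ = R⟨⟨Y⟩⟩ ⊕ R⟨⟨X⟩⟩x₀ → R⟨⟨Y⟩⟩`: it keeps the coefficients of the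
words in `Y`, which are the words of `X` that do not end with `x₀`. -/
def piY (R I : Type*) [CommRing R] : Series R (XLetter I) →ₗ[R] Series R (YLetter I) where
  toFun ψ w := ψ (yToX w)
  map_add' _ _ := rfl
  map_smul' _ _ := rfl

/-- The linear map that pulls coefficients back along a map of words. If `p` is a bijection of
words, this is the inverse of the linear automorphism that sends each word `w` to `p w`. -/
def pullback {A : Type*} (R : Type*) [CommRing R] (p : FreeMonoid A → FreeMonoid A) :
    Series R A →ₗ[R] Series R A where
  toFun ψ w := ψ (p w)
  map_add' _ _ := rfl
  map_smul' _ _ := rfl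

theorem finite_weight [Finite I] (n : ℕ) : {y : YLetter I | (y.1 : ℕ) = n}.Finite := by
  refine Set.Finite.subset (Set.Finite.prod
    (Set.Finite.preimage (PNat.coe_injective.injOn) (Set.finite_singleton n))
    (Set.finite_univ (α := I))) ?_
  intro y hy
  exact ⟨hy, trivial⟩

/-- The weight of a word in the letters `y_{k,i}`: the sum of the `k`. -/
def weight (w : FreeMonoid (YLetter I)) : ℕ := (w.toList.map fun y => (y.1 : ℕ)).sum

theorem weight_mul (v w : FreeMonoid (YLetter I)) : weight (v * w) = weight v + weight w := by
  simp [weight]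

/-- A coproduct on `R⟨⟨Y⟩⟩` of the form
`y ↦ y ⊗ 1 + 1 ⊗ y + ∑ y' ⊗ y''`, the sum over a finite set `S y` of pairs `(y', y'')`. -/
def stuffleLetter (R : Type*) [CommRing R] (S : YLetter I → Finset (YLetter I × YLetter I))
    (y : YLetter I) : MonoidAlgebra R (FreeMonoid (YLetter I) × FreeMonoid (YLetter I)) :=
  mono R (FreeMonoid.of y, 1) + mono R (1, FreeMonoid.of y) +
    ∑ p ∈ S y, mono R (FreeMonoid.of p.1, FreeMonoid.of p.2)

theorem locallyFinite_stuffleLetter (R : Type*) [CommRing R] [Finite I]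
    (S : YLetter I → Finset (YLetter I × YLetter I))
    (hS : ∀ y, ∀ p ∈ S y, p.1.1 + p.2.1 = y.1) : LocallyFinite (stuffleLetter R S) := by
  refine locallyFinite_of_weight _ (fun y => (y.1 : ℕ)) (fun y => y.1.pos) finite_weight
    (fun p => weight p.1 + weight p.2) (by simp [weight])
    (fun x y => by simp only [Prod.fst_mul, Prod.snd_mul, weight_mul]; ring)
    fun y m hm => ?_
  rw [stuffleLetter, MonoidAlgebra.coeff_add, MonoidAlgebra.coeff_add, MonoidAlgebra.coeff_sum,
    Finsupp.add_apply, Finsupp.add_apply, Finsupp.finsetSum_apply] at hm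
  by_cases h1 : (mono R ((FreeMonoid.of y, 1) :
      FreeMonoid (YLetter I) × FreeMonoid (YLetter I))).coeff m = 0
  · by_cases h2 : (mono R ((1, FreeMonoid.of y) :
      FreeMonoid (YLetter I) × FreeMonoid (YLetter I))).coeff m = 0
    · rw [h1, h2, zero_add, zero_add] at hm
      obtain ⟨p, hp, hpm⟩ := Finset.exists_ne_zero_of_sum_ne_zero hm
      rw [coeff_mono_ne_zero hpm]
      have := congrArg (fun k : ℕ+ => (k : ℕ)) (hS y p hp)
      simpa [weight] using this
    · rw [coeff_mono_ne_zero h2]; simp [weight]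
  · rw [coeff_mono_ne_zero h1]; simp [weight]

open scoped Classical in
/-- The pairs `(k₁, k₂)` of positive integers with `k₁ + k₂ = k`. -/
def splittings (k : ℕ+) : Finset (ℕ+ × ℕ+) := {p ∈ Iio k ×ˢ Iio k | p.1 + p.2 = k}

end Alphabets

/-! ### The Lie algebra of Racinet attached to `N`-th roots of unity -/

section Cyclotomic

variable (R G : Type*) [Field R] [CommGroup G] [Fintype G]

open scoped Classical in
/-- The index set `k₁ + k₂ = k`, `ζ₁ ζ₂ = ζ` of the harmonic coproduct of `y_{k,ζ}`. -/
def harmonicPairs (y : YLetter G) : Finset (YLetter G × YLetter G) :=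
  ((splittings y.1) ×ˢ ({q | q.1 * q.2 = y.2} : Finset (G × G))).image
    fun t => ((t.1.1, t.2.1), (t.1.2, t.2.2))

/-- The harmonic coproduct: the continuous algebra morphism with
`y_{k,ζ} ↦ y_{k,ζ} ⊗ 1 + 1 ⊗ y_{k,ζ} + ∑_{k₁+k₂=k, ζ₁ζ₂=ζ} y_{k₁,ζ₁} ⊗ y_{k₂,ζ₂}`. -/
def harmonicCoproduct :
    Series R (YLetter G) →ₗ[R] (FreeMonoid (YLetter G) × FreeMonoid (YLetter G) → R) :=
  extend (stuffleLetter R (harmonicPairs G)) (locallyFinite_stuffleLetter R _ (by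
    classical
    intro y p hp
    simp only [harmonicPairs, splittings, mem_image, mem_product, mem_filter] at hp
    obtain ⟨t, ⟨⟨_, ht⟩, _⟩, rfl⟩ := hp
    exact ht))

variable {G} in
/-- The map on words (lists of letters) that replaces the indices `ζ₁, ζ₂, …` of the successive
letters other than `x₀` by `c ζ₁, c ζ₁ ζ₂, …`. -/
def partialProducts (c : G) : List (XLetter G) → List (XLetter G)
  | [] => []
  | none :: w => none :: partialProducts c w
  | some g :: w => some (c * g) :: partialProducts (c * g) w

/-- `𝐩⁻¹`, where `𝐩` is the linear automorphism that sends
`x₀^{k₁-1} x_{ζ₁} x₀^{k₂-1} x_{ζ₂} ⋯ x₀^{k_r-1} x_{ζ_r} x₀^{k_{r+1}-1}` to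
`x₀^{k₁-1} x_{ζ₁} x₀^{k₂-1} x_{ζ₁ζ₂} ⋯ x₀^{k_r-1} x_{ζ₁⋯ζ_r} x₀^{k_{r+1}-1}`. -/
def pInv : Series R (XLetter G) →ₗ[R] Series R (XLetter G) :=
  pullback R fun w => FreeMonoid.ofList (partialProducts 1 w.toList)

open scoped Classical in
/-- The series `∑_{n ≥ 2} ((-1)^{n-1} / n) (ψ ∣ x₀^{n-1} x₁) y_{1,1}^n`. -/
def correction : Series R (XLetter G) →ₗ[R] Series R (YLetter G) where
  toFun ψ w :=
    if 2 ≤ w.length ∧ w = FreeMonoid.of ((1 : ℕ+), (1 : G)) ^ w.length then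
      (-1) ^ (w.length - 1) / (w.length : R) * ψ (zeroPowThen (w.length - 1) 1)
    else 0
  map_add' f g := by
    ext w; simp only [Pi.add_apply]; split_ifs <;> simp [mul_add]
  map_smul' c f := by
    ext w; simp only [Pi.smul_apply, smul_eq_mul, RingHom.id_apply]; split_ifs <;> ring

/-- `ψ_* = π_Y (𝐩⁻¹ ψ) + ∑_{n ≥ 2} ((-1)^{n-1} / n) (ψ ∣ x₀^{n-1} x₁) y_{1,1}^n`. -/
def star : Series R (XLetter G) →ₗ[R] Series R (YLetter G) :=
  piY R G ∘ₗ pInv R G + correction R G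

/-- The double shuffle Lie algebra `𝔡𝔪𝔯₀` over `R` attached to the finite abelian group `G`.
For `G = μ_N` and `R = ℚ` this is Racinet's `𝔡𝔪𝔯₀^{μ_N}`. -/
def dmrGroup : Submodule R (Series R (XLetter G)) where
  carrier := {ψ |
    (ψ (FreeMonoid.of none) = 0 ∧ ψ (FreeMonoid.of (some 1)) = 0) ∧
    shuffleCoproduct R (XLetter G) ψ = primitivePart R (XLetter G) ψ ∧
    (∀ g : G, ψ (FreeMonoid.of (some g)) - ψ (FreeMonoid.of (some g⁻¹)) = 0) ∧
    harmonicCoproduct R G (star R G ψ) = primitivePart R (YLetter G) (star R G ψ)}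
  add_mem' := by
    rintro f g ⟨⟨h1, h2⟩, h3, h4, h5⟩ ⟨⟨h1', h2'⟩, h3', h4', h5'⟩
    refine ⟨⟨by simp [h1, h1'], by simp [h2, h2']⟩, by rw [map_add, map_add, h3, h3'],
      fun x => ?_, by rw [map_add, map_add, map_add, h5, h5']⟩
    have := congrArg₂ (· + ·) (h4 x) (h4' x)
    simp only [Pi.add_apply]
    linear_combination this
  zero_mem' := by simp
  smul_mem' := by
    rintro c f ⟨⟨h1, h2⟩, h3, h4, h5⟩
    refine ⟨⟨by simp [h1], by simp [h2]⟩, by rw [map_smul, map_smul, h3],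
      fun x => ?_, by rw [map_smul, map_smul, map_smul, h5]⟩
    simp only [Pi.smul_apply, smul_eq_mul]
    linear_combination c * h4 x

variable {G}

/-- The algebra automorphism `t_ζ` of `R⟨⟨X⟩⟩`: `x₀ ↦ x₀` and `x_η ↦ x_{ζη}`. -/
def t (g : G) : Series R (XLetter G) →ₗ[R] Series R (XLetter G) :=
  rename R (Option.map fun h => g * h)

variable {R}

/-- The derivation `d_ψ` of `R⟨⟨X⟩⟩`: `x₀ ↦ 0` and `x_ζ ↦ [x_ζ, t_ζ(ψ)]`. -/
def d (ψ : Series R (XLetter G)) : Series R (XLetter G) → Series R (XLetter G) :=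
  derivation fun a => match a with
    | none => 0
    | some g => comm (letter R (some g)) (t R g ψ)

/-- The bracket `⟨ψ₁, ψ₂⟩ = d_{ψ₁}(ψ₂) - d_{ψ₂}(ψ₁) + [ψ₁, ψ₂]`. -/
def bracket (ψ₁ ψ₂ : Series R (XLetter G)) : Series R (XLetter G) :=
  d ψ₁ ψ₂ - d ψ₂ ψ₁ + comm ψ₁ ψ₂

end Cyclotomic

/-! ### The congruent double shuffle Lie algebra -/

section Congruent

variable (R : Type*) [Field R] (N : ℕ) [NeZero N]

open scoped Classical in
/-- The index set `k₁ + k₂ = k` of the harmonic coproduct of `ỹ_{k,α}`. -/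
def congruentPairs (y : YLetter (ZMod N)) : Finset (YLetter (ZMod N) × YLetter (ZMod N)) :=
  (splittings y.1).image fun q => ((q.1, y.2), (q.2, y.2))

/-- The harmonic coproduct: the continuous algebra morphism with
`ỹ_{k,α} ↦ ỹ_{k,α} ⊗ 1 + 1 ⊗ ỹ_{k,α} + ∑_{k₁+k₂=k} ỹ_{k₁,α} ⊗ ỹ_{k₂,α}`. -/
def congruentHarmonicCoproduct : Series R (YLetter (ZMod N)) →ₗ[R]
    (FreeMonoid (YLetter (ZMod N)) × FreeMonoid (YLetter (ZMod N)) → R) :=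
  extend (stuffleLetter R (congruentPairs N)) (locallyFinite_stuffleLetter R _ (by
    classical
    intro y p hp
    simp only [congruentPairs, splittings, mem_image, mem_filter] at hp
    obtain ⟨q, ⟨_, hq⟩, rfl⟩ := hp
    exact hq))

variable {N} in
/-- The index of the first letter of the word that is not `x̃`, and `0` if there is none. -/
def firstIndex : List (XLetter (ZMod N)) → ZMod N
  | [] => 0
  | none :: w => firstIndex w
  | some α :: _ => α

variable {N} in
/-- The map on words (lists of letters) that replaces the indices `α₁, …, α_r` of the successive
letters other than `x̃` by `α₁ - α₂, …, α_{r-1} - α_r, α_r`. -/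
def successiveDifferences : List (XLetter (ZMod N)) → List (XLetter (ZMod N))
  | [] => []
  | none :: w => none :: successiveDifferences w
  | some α :: w => some (α - firstIndex w) :: successiveDifferences w

/-- `𝐪⁻¹`, where `𝐪` is the linear automorphism that sends
`x̃^{k₁-1} x̃_{α₁} ⋯ x̃^{k_{r-1}-1} x̃_{α_{r-1}} x̃^{k_r-1} x̃_{α_r} x̃^{k_{r+1}-1}` to
`x̃^{k₁-1} x̃_{α₁-α₂} ⋯ x̃^{k_{r-1}-1} x̃_{α_{r-1}-α_r} x̃^{k_r-1} x̃_{α_r} x̃^{k_{r+1}-1}`. -/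
def qInv : Series R (XLetter (ZMod N)) →ₗ[R] Series R (XLetter (ZMod N)) :=
  pullback R fun w => FreeMonoid.ofList (successiveDifferences w.toList)

open scoped Classical in
/-- The series `∑_{n ≥ 2} ∑_{α, β₁, …, β_n ∈ ℤ/N}
((-1)^{n-1} / (n Nⁿ)) (ψ ∣ x̃^{n-1} x̃_α) ỹ_{1,β₁} ⋯ ỹ_{1,β_n}`.  The words `ỹ_{1,β₁} ⋯ ỹ_{1,β_n}`
are the words of length `n` all of whose letters have `k = 1`. -/
def congruentCorrection : Series R (XLetter (ZMod N)) →ₗ[R] Series R (YLetter (ZMod N)) where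
  toFun ψ w :=
    if 2 ≤ w.length ∧ ∀ y ∈ w.toList, y.1 = 1 then
      ∑ α : ZMod N, (-1) ^ (w.length - 1) / ((w.length : R) * (N : R) ^ w.length) *
        ψ (zeroPowThen (w.length - 1) α)
    else 0
  map_add' f g := by
    ext w; simp only [Pi.add_apply]; split_ifs <;> simp [mul_add, sum_add_distrib]
  map_smul' c f := by
    ext w; simp only [Pi.smul_apply, smul_eq_mul, RingHom.id_apply]
    split_ifs
    · rw [mul_sum]; exact sum_congr rfl fun _ _ => by ring
    · ring

/-- `ψ_* = π_Y (𝐪⁻¹ ψ) + ∑_{n ≥ 2} ∑_{α, β₁, …, β_n}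
((-1)^{n-1} / (n Nⁿ)) (ψ ∣ x̃^{n-1} x̃_α) ỹ_{1,β₁} ⋯ ỹ_{1,β_n}`. -/
def congruentStar : Series R (XLetter (ZMod N)) →ₗ[R] Series R (YLetter (ZMod N)) :=
  piY R (ZMod N) ∘ₗ qInv R N + congruentCorrection R N

/-- The congruent double shuffle Lie algebra; for `R = ℚ` this is `𝔡𝔪𝔯₀^{[N]}`. -/
def dmrCongruent : Submodule R (Series R (XLetter (ZMod N))) where
  carrier := {ψ |
    (ψ (FreeMonoid.of none) = 0 ∧ ∑ α : ZMod N, ψ (FreeMonoid.of (some α)) = 0) ∧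
    shuffleCoproduct R (XLetter (ZMod N)) ψ = primitivePart R (XLetter (ZMod N)) ψ ∧
    (∀ α : ZMod N, ψ (FreeMonoid.of (some α)) - ψ (FreeMonoid.of (some (-α))) = 0) ∧
    congruentHarmonicCoproduct R N (congruentStar R N ψ) =
      primitivePart R (YLetter (ZMod N)) (congruentStar R N ψ)}
  add_mem' := by
    rintro f g ⟨⟨h1, h2⟩, h3, h4, h5⟩ ⟨⟨h1', h2'⟩, h3', h4', h5'⟩
    refine ⟨⟨by simp [h1, h1'], by simp [sum_add_distrib, h2, h2']⟩,
      by rw [map_add, map_add, h3, h3'], fun x => ?_,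
      by rw [map_add, map_add, map_add, h5, h5']⟩
    have := congrArg₂ (· + ·) (h4 x) (h4' x)
    simp only [Pi.add_apply]
    linear_combination this
  zero_mem' := by simp
  smul_mem' := by
    rintro c f ⟨⟨h1, h2⟩, h3, h4, h5⟩
    refine ⟨⟨by simp [h1], by simp [← mul_sum, h2]⟩, by rw [map_smul, map_smul, h3],
      fun x => ?_, by rw [map_smul, map_smul, map_smul, h5]⟩
    simp only [Pi.smul_apply, smul_eq_mul]
    linear_combination c * h4 x

end Congruent

/-! ### Over the cyclotomic field `K = ℚ(μ_N)`

Since `ζ` is an `N`-th root of unity, `ζ ^ a` depends only on the class of `a` modulo `N`; it is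
written below as `ζ ^ (a : ZMod N).val`. -/

section Field

variable {N : ℕ} [NeZero N] {K : Type*} [Field K]

instance instFintypeRootsOfUnity (N : ℕ) [NeZero N] (K : Type*) [Field K] :
    Fintype (rootsOfUnity N K) := Fintype.ofFinite _

/-- The map `𝓕 : K⟨⟨X̃⟩⟩ → K⟨⟨X⟩⟩`, the continuous `K`-algebra morphism with
`x̃ ↦ x₀` and `x̃_α ↦ ∑_{m mod N} ζ^{-mα} x_{ζ^m}`. -/
def F {ζ : K} (hζ : IsPrimitiveRoot ζ N) :
    Series K (XLetter (ZMod N)) →ₗ[K] Series K (XLetter (rootsOfUnity N K)) :=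
  extend (fun a => match a with
    | none => mono K (FreeMonoid.of none)
    | some α => ∑ m : ZMod N, ζ ^ (-(m * α)).val •
        mono K (FreeMonoid.of (some (hζ.toRootsOfUnity ^ m.val)))) (by
    refine locallyFinite_of_weight _ (fun _ => 1) (fun _ => le_rfl) (fun _ => Set.toFinite _)
      FreeMonoid.length FreeMonoid.length_one FreeMonoid.length_mul fun x w hw => ?_
    cases x with
    | none => rw [coeff_mono_ne_zero hw]; rfl
    | some α =>
      simp only [MonoidAlgebra.coeff_sum, Finsupp.finsetSum_apply] at hw
      obtain ⟨m, -, hm⟩ := Finset.exists_ne_zero_of_sum_ne_zero hw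
      rw [MonoidAlgebra.coeff_smul, Finsupp.smul_apply] at hm
      rw [coeff_mono_ne_zero (right_ne_zero_of_mul hm)]
      rfl)

open scoped Classical in
/-- The algebra automorphism `t̃_m` of `K⟨⟨X̃⟩⟩`: `x̃ ↦ x̃` and `x̃_α ↦ ζ^{mα} x̃_α`. -/
def tTilde (ζ : K) (m : ZMod N) :
    Series K (XLetter (ZMod N)) →ₗ[K] Series K (XLetter (ZMod N)) :=
  substitute fun a b => if a = b then (match a with
    | none => 1
    | some α => ζ ^ (m * α).val) else 0

/-- The operator `T̃_α = (1/N) ∑_{m mod N} ζ^{-mα} t̃_m`. -/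
def TTilde (ζ : K) (α : ZMod N) :
    Series K (XLetter (ZMod N)) →ₗ[K] Series K (XLetter (ZMod N)) :=
  (1 / (N : K)) • ∑ m : ZMod N, ζ ^ (-(m * α)).val • tTilde ζ m

/-- The derivation `d̃_ψ`: `x̃ ↦ 0` and `x̃_α ↦ T̃_α([∑_β x̃_β, ψ])`. -/
def dTilde (ζ : K) (ψ : Series K (XLetter (ZMod N))) :
    Series K (XLetter (ZMod N)) → Series K (XLetter (ZMod N)) :=
  derivation fun a => match a with
    | none => 0
    | some α => TTilde ζ α (comm (∑ β : ZMod N, letter K (some β)) ψ)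

/-- The bracket `⟨ψ₁, ψ₂⟩~ = d̃_{ψ₁}(ψ₂) - d̃_{ψ₂}(ψ₁) + [ψ₁, ψ₂]`. -/
def bracketTilde (ζ : K) (ψ₁ ψ₂ : Series K (XLetter (ZMod N))) : Series K (XLetter (ZMod N)) :=
  dTilde ζ ψ₁ ψ₂ - dTilde ζ ψ₂ ψ₁ + comm ψ₁ ψ₂

variable [Algebra ℚ K]

/-- The Galois action on coefficients, `σ ⊗ id`. -/
def coeffAct {A : Type*} (σ : K ≃ₐ[ℚ] K) : Series K A →ₗ[ℚ] Series K A where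
  toFun f w := σ (f w)
  map_add' f g := by ext w; simp
  map_smul' c f := by ext w; simp

/-- The algebra automorphism `δ_γ`: `x₀ ↦ x₀` and `x_η ↦ x_{η^γ}`. -/
def delta (γ : (ZMod N)ˣ) : Series K (XLetter (rootsOfUnity N K)) →ₗ[K]
    Series K (XLetter (rootsOfUnity N K)) :=
  rename K (Option.map fun η => η ^ (γ : ZMod N).val)

/-- The algebra automorphism `δ̃_γ`: `x̃ ↦ x̃` and `x̃_α ↦ x̃_{γα}`. -/
def deltaTilde (γ : (ZMod N)ˣ) :
    Series K (XLetter (ZMod N)) →ₗ[K] Series K (XLetter (ZMod N)) :=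
  rename K (Option.map fun α => (γ : ZMod N) * α)

/-- The action `Δ_σ` of `σ ∈ Gal(K/ℚ)` on `K⟨⟨X⟩⟩`: the Galois action on coefficients and `δ_γ` on
the letters, where `γ ∈ (ℤ/N)ˣ` is the class with `σ(ζ) = ζ^γ`. -/
def Delta {ζ : K} (hζ : IsPrimitiveRoot ζ N) (σ : K ≃ₐ[ℚ] K) :
    Series K (XLetter (rootsOfUnity N K)) →ₗ[ℚ] Series K (XLetter (rootsOfUnity N K)) :=
  (delta (hζ.autToPow ℚ σ)).restrictScalars ℚ ∘ₗ coeffAct σ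

/-- The action `Δ̃_σ` of `σ ∈ Gal(K/ℚ)` on `K⟨⟨X̃⟩⟩`: the Galois action on coefficients and `δ̃_γ`
on the letters, where `γ ∈ (ℤ/N)ˣ` is the class with `σ(ζ) = ζ^γ`. -/
def DeltaTilde {ζ : K} (hζ : IsPrimitiveRoot ζ N) (σ : K ≃ₐ[ℚ] K) :
    Series K (XLetter (ZMod N)) →ₗ[ℚ] Series K (XLetter (ZMod N)) :=
  (deltaTilde (hζ.autToPow ℚ σ)).restrictScalars ℚ ∘ₗ coeffAct σ

/-- The `ℚ`-subspace of the elements of `V` that are fixed by a family of operators. -/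
def invariants {A : Type*} (V : Submodule K (Series K A))
    (act : (K ≃ₐ[ℚ] K) → Series K A →ₗ[ℚ] Series K A) : Submodule ℚ (Series K A) where
  carrier := {f | f ∈ V ∧ ∀ σ, act σ f = f}
  add_mem' := by
    rintro f g ⟨hf, hf'⟩ ⟨hg, hg'⟩
    exact ⟨add_mem hf hg, fun σ => by rw [map_add, hf' σ, hg' σ]⟩
  zero_mem' := ⟨zero_mem _, fun σ => map_zero _⟩
  smul_mem' := by
    rintro c f ⟨hf, hf'⟩
    refine ⟨?_, fun σ => by rw [map_smul, hf' σ]⟩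
    rw [← algebraMap_smul K c f]
    exact V.smul_mem _ hf

/-- The invariant subspace of `K ⊗̂ 𝔡𝔪𝔯₀^{μ_N}` under the action `σ ↦ Δ_σ`. -/
def invariantsMu {ζ : K} (hζ : IsPrimitiveRoot ζ N) :
    Submodule ℚ (Series K (XLetter (rootsOfUnity N K))) :=
  invariants (completedTensor K (dmrGroup ℚ (rootsOfUnity N K))) (Delta hζ)

/-- The invariant subspace of `K ⊗̂ 𝔡𝔪𝔯₀^{[N]}` under the action `σ ↦ Δ̃_σ`. -/
def invariantsCongruent {ζ : K} (hζ : IsPrimitiveRoot ζ N) :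
    Submodule ℚ (Series K (XLetter (ZMod N))) :=
  invariants (completedTensor K (dmrCongruent ℚ N)) (DeltaTilde hζ)

end Field

end DoubleShuffle

end

/-!
Over `K`, the map `𝓕` is the discrete Fourier transform on the indices of the letters: it sends
`x̃_α` to `∑ g, g^{-α} x_g`, the sum over the `N`-th roots of unity `g`.  The character table is
invertible, so `𝓕` is bijective, and it turns each ingredient of one double shuffle Lie algebra into
the corresponding ingredient of the other.

* The coproducts are dual to quasi-shuffle products of words (`extend_eq_quasiCoproduct`), for the
  contraction `(g, h) ↦ g h` of indices on the side of the roots of unity, and for the contraction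
  `(α, α) ↦ α`, undefined on pairs of distinct classes, on the side of the congruence classes.  As
  the Fourier transform exchanges the convolution and the pointwise product, it is a morphism of
  coalgebras (`quasiCoproduct_transform`).
* The partial products of `𝐩` correspond to the successive differences of `𝐪` by a change of
  variables in the Fourier sum (`xTransform_fourier_partialProducts`), and the two correction terms
  correspond to each other because `∑_β g^{-β}` is `N` for `g = 1` and vanishes otherwise.

Hence a series `f` over `K` belongs to the congruent Lie algebra over `K` if and only if `𝓕 f`
belongs to the Lie algebra of Racinet over `K` (`F_mem_dmrGroup_iff`).

Both Lie algebras are cut out by finite rational linear combinations of coefficients, the same over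
`ℚ` and over `K`.  As `K` is finite over `ℚ`, this implies that the completed tensor product of `K`
with the rational Lie algebra is the Lie algebra over `K` (`completedTensor_eq`).

Finally `𝓕 ∘ Δ̃_σ = σ ∘ 𝓕` and `Δ_σ ∘ 𝓕 = 𝓕 ∘ σ`, where `σ` acts on coefficients (`F_DeltaTilde`,
`Delta_F`).  So `𝓕 f` has rational coefficients exactly when `f` is fixed by the `Δ̃_σ`, and `𝓕 f` is
fixed by the `Δ_σ` exactly when `f` has rational coefficients.  The brackets correspond to each other
because `𝓕` carries `t̃_m` to `t_{ζ^m}` and `∑_β x̃_β` to `N x₁` (`F_bracketTilde`).  The operators `T̃_α`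
are projections to spans of words (`TTilde_apply`), which is why `⟨·,·⟩~` preserves rationality.
-/

noncomputable section

namespace DoubleShuffle

open Finset

/-! ### Left quotients of series -/

section Shift

variable {R A B M : Type*} [CommRing R]

/-- The left quotient of a series by the word `u`: the coefficient at `w` is the coefficient of the
series at `u w`. -/
def shift (u : FreeMonoid A) : Series R A →ₗ[R] Series R A := LinearMap.funLeft R R (u * ·)

theorem shift_apply (u : FreeMonoid A) (f : Series R A) (w : FreeMonoid A) :
    shift u f w = f (u * w) := rfl

theorem shift_mul (u v : FreeMonoid A) (f : Series R A) :
    shift (u * v) f = shift v (shift u f) := by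
  ext w; simp only [shift_apply, mul_assoc]

theorem mul_apply_one (f g : Series R A) : mul f g 1 = f 1 * g 1 := by
  simp [mul, FreeMonoid.ofList_nil]

theorem mul_apply_of_mul (f g : Series R A) (a : A) (w : FreeMonoid A) :
    mul f g (FreeMonoid.of a * w) =
      f 1 * g (FreeMonoid.of a * w) + mul (shift (FreeMonoid.of a) f) g w := by
  simp only [mul, FreeMonoid.length_mul, FreeMonoid.length_of, FreeMonoid.toList_of_mul]
  rw [add_comm 1, sum_range_succ', add_comm]
  rfl

theorem shift_mul_series (f g : Series R A) (a : A) :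
    shift (FreeMonoid.of a) (mul f g) =
      f 1 • shift (FreeMonoid.of a) g + mul (shift (FreeMonoid.of a) f) g := by
  ext w; exact mul_apply_of_mul f g a w

/-- The product of series, as a bilinear map. -/
def mulBilin (R A : Type*) [CommRing R] : Series R A →ₗ[R] Series R A →ₗ[R] Series R A :=
  LinearMap.mk₂ R mul
    (fun f f' g => by ext w; simp [mul, add_mul, sum_add_distrib])
    (fun c f g => by ext w; simp [mul, mul_assoc, mul_sum])
    (fun f g g' => by ext w; simp [mul, mul_add, sum_add_distrib])
    (fun c f g => by ext w; simp [mul, mul_left_comm, mul_sum])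

theorem mulBilin_apply (f g : Series R A) : mulBilin R A f g = mul f g := rfl

theorem derivation_apply_one [Fintype A] (D : A → Series R A) (f : Series R A) :
    derivation D f 1 = ∑ a, mul (D a) (shift (FreeMonoid.of a) f) 1 := by
  simp [derivation, mul_apply_one, shift_apply, mul_comm]

/-- The derivation of series with given values on letters, as a linear map. -/
def derivationLinear [Fintype A] (D : A → Series R A) : Series R A →ₗ[R] Series R A where
  toFun := derivation D
  map_add' f g := by ext w; simp only [derivation, Pi.add_apply, add_mul, sum_add_distrib]
  map_smul' c f := by
    ext w
    simp only [derivation, Pi.smul_apply, smul_eq_mul, mul_assoc, mul_sum, RingHom.id_apply]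

theorem derivationLinear_apply [Fintype A] (D : A → Series R A) (f : Series R A) :
    derivationLinear D f = derivation D f := rfl

/-- The Leibniz rule, by the position of the letter on which the derivation acts: it is either the
first letter of the word or a later one. -/
theorem derivation_apply_of_mul [Fintype A] (D : A → Series R A) (f : Series R A) (b : A)
    (w : FreeMonoid A) :
    derivation D f (FreeMonoid.of b * w) =
      ∑ a, mul (D a) (shift (FreeMonoid.of a) f) (FreeMonoid.of b * w) +
        derivation D (shift (FreeMonoid.of b) f) w := by
  simp only [derivation, FreeMonoid.length_mul, FreeMonoid.length_of, FreeMonoid.toList_of_mul]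
  rw [add_comm 1, sum_range_succ', add_comm]
  congr 1
  · rw [sum_comm]
    refine sum_congr rfl fun a _ => ?_
    rw [mul, ← Nat.range_succ_eq_Icc_zero, FreeMonoid.length_mul, FreeMonoid.length_of,
      add_comm 1 w.length]
    exact sum_congr rfl fun j _ => mul_comm _ _
  · refine sum_congr rfl fun i _ => ?_
    rw [← map_add_right_Icc i w.length 1, sum_map]
    simp only [addRightEmbedding_apply, List.take_succ_cons, List.drop_succ_cons,
      Nat.add_sub_add_right]
    rfl

end Shift

/-! ### Linear substitutions of letters -/

section Transform

variable {R A B C : Type*} [CommRing R]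

/-- The coefficient at a word of the image of a series under `transform c`. -/
def transformAt (c : B → A →₀ R) : List B → Series R A →ₗ[R] R
  | [] => LinearMap.proj 1
  | b :: w =>
    Finsupp.linearCombination R (fun a => transformAt c w ∘ₗ shift (FreeMonoid.of a)) (c b)

/-- The continuous algebra morphism `R⟨⟨A⟩⟩ → R⟨⟨B⟩⟩` that sends each letter `a` to
`∑ b, c b a • b`.  The coefficients are indexed by the letters of the target: the row `c b`
has to be finite, while the image of a letter may be an infinite sum. -/
def transform (c : B → A →₀ R) : Series R A →ₗ[R] Series R B :=
  LinearMap.pi fun w => transformAt c w.toList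

theorem transform_apply_one (c : B → A →₀ R) (f : Series R A) : transform c f 1 = f 1 := rfl

theorem transform_apply_of_mul (c : B → A →₀ R) (f : Series R A) (b : B) (w : FreeMonoid B) :
    transform c f (FreeMonoid.of b * w) =
      Finsupp.linearCombination R (fun a => transform c (shift (FreeMonoid.of a) f) w) (c b) := by
  change (Finsupp.linearCombination R
    (fun a => transformAt c w.toList ∘ₗ shift (FreeMonoid.of a)) (c b)) f = _
  simp only [Finsupp.linearCombination_apply, Finsupp.sum, LinearMap.sum_apply]
  rfl

theorem shift_transform (c : B → A →₀ R) (f : Series R A) (b : B) :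
    shift (FreeMonoid.of b) (transform c f) = transform c
      (Finsupp.linearCombination R (fun a => shift (FreeMonoid.of a) f) (c b)) := by
  ext w
  rw [shift_apply, transform_apply_of_mul]
  exact (Finsupp.apply_linearCombination R (LinearMap.proj w ∘ₗ transform c) _ _).symm

theorem transform_transform (c : C → B →₀ R) (c' : B → A →₀ R) (f : Series R A) :
    transform c (transform c' f) =
      transform (fun x => Finsupp.linearCombination R c' (c x)) f := by
  ext w
  induction w using FreeMonoid.inductionOn' generalizing f with
  | one => rfl
  | of_mul x w ih =>
    rw [transform_apply_of_mul, transform_apply_of_mul]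
    simp only [shift_transform, ih]
    have h := Finsupp.apply_linearCombination R
      (LinearMap.proj w ∘ₗ transform (fun x => Finsupp.linearCombination R c' (c x)) ∘ₗ
        Finsupp.linearCombination R (fun a => shift (R := R) (FreeMonoid.of a) f)) c' (c x)
    refine h.symm.trans ?_
    exact Finsupp.apply_linearCombination R
      (LinearMap.proj w ∘ₗ transform (fun x => Finsupp.linearCombination R c' (c x))) _ _

theorem transform_single (f : Series R A) :
    transform (fun a => Finsupp.single a (1 : R)) f = f := by
  ext w
  induction w using FreeMonoid.inductionOn' generalizing f with
  | one => rfl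
  | of_mul x w ih => rw [transform_apply_of_mul]; simp [ih, shift_apply]

theorem transform_mul (c : B → A →₀ R) (f g : Series R A) :
    transform c (mul f g) = mul (transform c f) (transform c g) := by
  ext w
  induction w using FreeMonoid.inductionOn' generalizing f with
  | one => simp only [transform_apply_one, mul_apply_one]
  | of_mul x w ih =>
    rw [mul_apply_of_mul, transform_apply_of_mul, transform_apply_of_mul, shift_transform, ← ih]
    simp only [shift_mul_series, map_add, map_smul, Pi.add_apply, Pi.smul_apply]
    rw [transform_apply_one]
    simp only [Finsupp.linearCombination_apply, Finsupp.sum, smul_add, sum_add_distrib]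
    congr 1
    · simp only [smul_eq_mul, mul_sum]
      exact sum_congr rfl fun _ _ => mul_left_comm _ _ _
    · simp only [← mulBilin_apply, map_sum, map_smul, LinearMap.sum_apply, LinearMap.smul_apply,
        Finset.sum_apply, Pi.smul_apply]

theorem transform_comm (c : B → A →₀ R) (f g : Series R A) :
    transform c (comm f g) = comm (transform c f) (transform c g) := by
  simp only [comm, map_sub, transform_mul]

/-- A morphism `transform c` intertwines two derivations as soon as it does so on letters. -/
theorem transform_derivation [Fintype A] [Fintype B] (c : B → A →₀ R) (D : A → Series R A)
    (D' : B → Series R B) (h : ∀ a, transform c (D a) = ∑ b, c b a • D' b) (f : Series R A) :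
    transform c (derivation D f) = derivation D' (transform c f) := by
  -- The terms in which the derivation acts on the first letter of a word.
  have key : ∀ (f : Series R A), transform c (∑ a, mul (D a) (shift (FreeMonoid.of a) f)) =
      ∑ b, mul (D' b) (shift (FreeMonoid.of b) (transform c f)) := by
    intro f
    simp only [map_sum, transform_mul, h, shift_transform]
    simp only [Finsupp.linearCombination_apply, ← mulBilin_apply, map_sum, LinearMap.sum_apply]
    rw [sum_comm]
    refine sum_congr rfl fun b _ => ?_
    rw [Finsupp.sum_fintype _ _ (by simp)]
    simp
  ext w
  induction w using FreeMonoid.inductionOn' generalizing f with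
  | one =>
    rw [derivation_apply_one, ← Finset.sum_apply, ← key, transform_apply_one, transform_apply_one,
      derivation_apply_one, Finset.sum_apply]
  | of_mul b w ih =>
    have hs : ∀ a, shift (FreeMonoid.of a) (derivation D f) =
        shift (FreeMonoid.of a) (∑ a', mul (D a') (shift (FreeMonoid.of a') f)) +
          derivation D (shift (FreeMonoid.of a) f) := by
      intro a; ext v
      rw [shift_apply, derivation_apply_of_mul]
      simp [shift_apply]
    rw [derivation_apply_of_mul, ← Finset.sum_apply, ← key, transform_apply_of_mul,
      transform_apply_of_mul, shift_transform]
    simp only [hs, map_add, Pi.add_apply]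
    rw [← ih]
    simp only [Finsupp.linearCombination_apply, Finsupp.sum, smul_add, sum_add_distrib]
    congr 1
    simp only [← derivationLinear_apply, map_sum, map_smul, Finset.sum_apply, Pi.smul_apply]

theorem transform_one (c : B → A →₀ R) : transform c (one R A) = one R B := by
  ext w
  induction w using FreeMonoid.inductionOn' with
  | one => simp [transform_apply_one, one]
  | of_mul x w ih =>
    have h : ∀ a : A, shift (FreeMonoid.of a) (one R A) = 0 := by
      intro a; ext v; simp [shift_apply, one]
    rw [transform_apply_of_mul]
    simp only [h, map_zero, Pi.zero_apply]
    simp [one, Finsupp.linearCombination_apply]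

theorem transform_letter [Fintype B] (c : B → A →₀ R) (a : A) :
    transform c (letter R a) = ∑ b, c b a • letter R b := by
  classical
  ext w
  induction w using FreeMonoid.inductionOn' with
  | one => simp [transform_apply_one, letter, Finset.sum_apply]
  | of_mul x w ih =>
    have h : ∀ a' : A, shift (FreeMonoid.of a') (letter R a) = if a' = a then one R A else 0 := by
      intro a'; ext v
      split_ifs with ha
      · subst ha; simp [shift_apply, letter, one, Pi.single_apply]
      · have : FreeMonoid.of a' * v ≠ FreeMonoid.of a := fun h => ha (List.cons.inj h).1
        simp [shift_apply, letter, this]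
    rw [transform_apply_of_mul]
    have hL : (fun a' => transform c (shift (FreeMonoid.of a') (letter R a)) w) =
        Pi.single a (one R B w) := by
      ext a'
      rw [h]
      split_ifs with ha
      · subst ha; simp [transform_one]
      · simp [ha]
    rw [hL, Finset.sum_apply, Finset.sum_eq_single x]
    · rw [Finsupp.linearCombination_apply, Finsupp.sum, Finset.sum_eq_single a]
      · by_cases hw : w = 1
        · simp [letter, one, hw]
        · have : FreeMonoid.of x * w ≠ FreeMonoid.of x := fun h => hw (by simpa using h)
          simp [letter, one, hw, this]
      · intro a' _ ha'; simp [ha']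
      · intro ha; simp [Finsupp.notMem_support_iff.1 ha]
    · intro b _ hb
      have : FreeMonoid.of x * w ≠ FreeMonoid.of b := fun h => hb (List.cons.inj h).1.symm
      simp [letter, this]
    · simp

end Transform

/-! ### Continuous algebra morphisms, by the first letter of a word -/

section Extend

variable {R A B M : Type*} [CommRing R]

theorem finite_support_extend [Monoid M] (φ : A → MonoidAlgebra R M) (hφ : LocallyFinite φ)
    (ψ : Series R A) (m : M) :
    (Function.support fun w => ψ w * (FreeMonoid.lift φ w).coeff m).Finite :=
  (hφ m).subset fun _ hw => right_ne_zero_of_mul hw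

/-- The image of a series under a continuous algebra morphism, computed by splitting off the first
letter of each word. -/
theorem extend_apply_eq_finsum [Monoid M] (φ : A → MonoidAlgebra R M) (hφ : LocallyFinite φ)
    (ψ : Series R A) (m : M) :
    extend φ hφ ψ m = ψ 1 * (1 : MonoidAlgebra R M).coeff m +
      ∑ᶠ p : A × FreeMonoid A, ψ (FreeMonoid.of p.1 * p.2) *
        (φ p.1 * FreeMonoid.lift φ p.2).coeff m := by
  change ∑ᶠ w : FreeMonoid A, ψ w * (FreeMonoid.lift φ w).coeff m = _
  have hfin := finite_support_extend φ hφ ψ m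
  let e : Option (A × FreeMonoid A) ≃ FreeMonoid A :=
    { toFun := fun o => o.elim 1 fun p => FreeMonoid.of p.1 * p.2
      invFun := fun w => match w.toList with
        | [] => none
        | a :: w => some (a, FreeMonoid.ofList w)
      left_inv := fun o => by rcases o with _ | p <;> rfl
      right_inv := fun w => by
        cases w using FreeMonoid.casesOn <;> rfl }
  rw [← finsum_comp_equiv e, finsum_option]
  · simp [e]
  · exact (hfin.preimage e.injective.injOn).preimage (Option.some_injective _).injOn

theorem extend_shift [Monoid M] (φ : A → MonoidAlgebra R M) (hφ : LocallyFinite φ)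
    (ψ : Series R A) (a : A) (m : M) :
    extend φ hφ (shift (FreeMonoid.of a) ψ) m =
      ∑ᶠ w, ψ (FreeMonoid.of a * w) * (FreeMonoid.lift φ w).coeff m := rfl

/-- A sum over pairs that is concentrated on one letter. -/
theorem finsum_prod_eq_single {C : Type*} (g : A × C → R) (a : A)
    (h : ∀ p, p.1 ≠ a → g p = 0) : ∑ᶠ p, g p = ∑ᶠ x, g (a, x) := by
  have hinj : Function.Injective fun x : C => (a, x) := fun x y h => (Prod.mk.inj h).2
  rw [← finsum_mem_range hinj, ← finsum_mem_univ]
  refine (finsum_mem_inter_support_eq' _ _ _ fun p hp => ?_)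
  simp only [Set.mem_univ, Set.mem_range, true_iff]
  by_contra hne
  exact hp (h p fun hpa => hne ⟨p.2, by rw [← hpa]⟩)

theorem coeff_mono_mul_mul [Monoid M] [IsLeftCancelMul M] (m m' : M) (x : MonoidAlgebra R M) :
    (mono R m * x).coeff (m * m') = x.coeff m' := by
  rw [mono, MonoidAlgebra.coeff_single_mul_eq_mul_coeff m' (fun d _ => mul_right_inj m), one_mul]

theorem coeff_mono_mul_of_ne [Monoid M] (m m' : M) (x : MonoidAlgebra R M)
    (h : ∀ d, m * d ≠ m') : (mono R m * x).coeff m' = 0 :=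
  MonoidAlgebra.coeff_single_mul_of_forall_mul_ne _ _ h

theorem of_mul_ne_of_mul {a b : A} (h : a ≠ b) (v w : FreeMonoid A) :
    FreeMonoid.of a * v ≠ FreeMonoid.of b * w := fun h' => h (List.cons.inj h').1

/-- A substitution of letters by linear combinations of letters is the transform whose rows are
the rows of its matrix. -/
theorem substitute_eq_transform [Fintype A] [Fintype B] (c : A → B → R) (ψ : Series R A) :
    substitute c ψ = transform (fun b => Finsupp.equivFunOnFinite.symm fun a => c a b) ψ := by
  classical
  ext w
  induction w using FreeMonoid.inductionOn' generalizing ψ with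
  | one =>
    rw [substitute, extend_apply_eq_finsum, transform_apply_one, finsum_eq_zero_of_forall_eq_zero]
    · simp
    · intro p
      simp [linearLetter, sum_mul, coeff_mono_mul_of_ne]
  | of_mul b w ih =>
    have key : ∀ p : A × FreeMonoid A,
        (linearLetter c p.1 * FreeMonoid.lift (linearLetter c) p.2).coeff (FreeMonoid.of b * w) =
          c p.1 b * (FreeMonoid.lift (linearLetter c) p.2).coeff w := by
      intro p
      rw [linearLetter, sum_mul, MonoidAlgebra.coeff_sum, Finsupp.finsetSum_apply,
        Finset.sum_eq_single b]
      · rw [smul_mul_assoc, MonoidAlgebra.coeff_smul, Finsupp.smul_apply, coeff_mono_mul_mul,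
          smul_eq_mul]
      · intro b' _ hb'
        rw [smul_mul_assoc, MonoidAlgebra.coeff_smul, Finsupp.smul_apply, coeff_mono_mul_of_ne,
          smul_zero]
        exact fun d => of_mul_ne_of_mul hb' _ _
      · simp
    have hloc := locallyFinite_linearLetter c
    rw [transform_apply_of_mul, substitute, extend_apply_eq_finsum, finsum_curry]
    · rw [finsum_eq_sum_of_fintype, Finsupp.linearCombination_apply,
        Finsupp.sum_fintype _ _ (by simp)]
      have h1 : (1 : MonoidAlgebra R (FreeMonoid B)).coeff (FreeMonoid.of b * w) = 0 := by
        simp [MonoidAlgebra.one_def]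
      rw [h1, mul_zero, zero_add]
      refine sum_congr rfl fun a _ => ?_
      rw [← ih, substitute, extend_shift, smul_eq_mul,
        mul_finsum' _ _ (finite_support_extend _ hloc _ _)]
      refine finsum_congr fun v => ?_
      rw [key]
      exact mul_left_comm _ _ _
    · refine ((hloc (FreeMonoid.of b * w)).preimage (f := fun p : A × FreeMonoid A =>
        FreeMonoid.of p.1 * p.2) ?_).subset fun p hp => ?_
      · intro p _ q _ hpq
        exact Prod.ext (List.cons.inj hpq).1 (List.cons.inj hpq).2
      · have := right_ne_zero_of_mul hp
        rw [Set.mem_preimage, Set.mem_ofPred_eq, map_mul (FreeMonoid.lift _),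
          FreeMonoid.lift_eval_of]
        exact this

end Extend

/-! ### Quasi-shuffle coproducts -/

section QuasiShuffle

variable {R A B : Type*} [CommRing R]

/-- The quasi-shuffle product of two words, with multiplicities, for a partially defined
contraction `op` of pairs of letters.  The shuffle product is the case where `op` is nowhere
defined. -/
def quasiShuffle (op : A → A → Option A) : List A → List A → Multiset (FreeMonoid A)
  | [], v => {FreeMonoid.ofList v}
  | a :: u, [] => {FreeMonoid.ofList (a :: u)}
  | a :: u, b :: v =>
    (quasiShuffle op u (b :: v)).map (FreeMonoid.of a * ·) +
      (quasiShuffle op (a :: u) v).map (FreeMonoid.of b * ·) +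
      (op a b).elim 0 fun c => (quasiShuffle op u v).map (FreeMonoid.of c * ·)
termination_by u v => u.length + v.length

/-- The coproduct of series dual to the quasi-shuffle product of words. -/
def quasiCoproduct (R : Type*) [CommRing R] (op : A → A → Option A) :
    Series R A →ₗ[R] (FreeMonoid A × FreeMonoid A → R) where
  toFun f p := ((quasiShuffle op p.1.toList p.2.toList).map f).sum
  map_add' f g := by ext p; exact Multiset.sum_map_add
  map_smul' c f := by ext p; exact Multiset.sum_map_mul_left

theorem quasiCoproduct_apply (op : A → A → Option A) (f : Series R A) (u v : FreeMonoid A) :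
    quasiCoproduct R op f (u, v) = ((quasiShuffle op u.toList v.toList).map f).sum := rfl

theorem quasiCoproduct_one_left (op : A → A → Option A) (f : Series R A) (v : FreeMonoid A) :
    quasiCoproduct R op f (1, v) = f v := by
  simp [quasiCoproduct_apply, quasiShuffle]

theorem quasiCoproduct_one_right (op : A → A → Option A) (f : Series R A) (u : FreeMonoid A) :
    quasiCoproduct R op f (u, 1) = f u := by
  rw [quasiCoproduct_apply]
  induction u using FreeMonoid.casesOn <;> simp [quasiShuffle, FreeMonoid.ofList_cons]

theorem quasiCoproduct_of_mul (op : A → A → Option A) (f : Series R A) (a b : A)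
    (u v : FreeMonoid A) :
    quasiCoproduct R op f (FreeMonoid.of a * u, FreeMonoid.of b * v) =
      quasiCoproduct R op (shift (FreeMonoid.of a) f) (u, FreeMonoid.of b * v) +
        quasiCoproduct R op (shift (FreeMonoid.of b) f) (FreeMonoid.of a * u, v) +
        (op a b).elim 0 fun c => quasiCoproduct R op (shift (FreeMonoid.of c) f) (u, v) := by
  simp only [quasiCoproduct_apply, FreeMonoid.toList_of_mul]
  rw [quasiShuffle, Multiset.map_add, Multiset.map_add, Multiset.sum_add, Multiset.sum_add,
    Multiset.map_map, Multiset.map_map]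
  cases op a b with
  | none => simp; rfl
  | some c => simp only [Option.elim, Multiset.map_map]; rfl

/-- The part of the image of a series that comes from words with a given first letter. -/
theorem finsum_ite_letter {M : Type*} [Monoid M] (φ : A → MonoidAlgebra R M) (hφ : LocallyFinite φ)
    (ψ : Series R A) (o : Option A) (m : M) [∀ x, Decidable (o = some x)] :
    (Function.support fun p : A × FreeMonoid A => if o = some p.1 then
        ψ (FreeMonoid.of p.1 * p.2) * (FreeMonoid.lift φ p.2).coeff m else 0).Finite ∧
    ∑ᶠ p : A × FreeMonoid A, (if o = some p.1 then
      ψ (FreeMonoid.of p.1 * p.2) * (FreeMonoid.lift φ p.2).coeff m else 0) =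
      o.elim 0 fun a => extend φ hφ (shift (FreeMonoid.of a) ψ) m := by
  cases o with
  | none => simp
  | some a =>
    constructor
    · refine ((hφ m).image fun w => (a, w)).subset fun p hp => ?_
      rw [Function.mem_support] at hp
      split_ifs at hp with h
      · exact ⟨p.2, right_ne_zero_of_mul hp, by rw [Option.some.inj h]⟩
      · exact absurd rfl hp
    · rw [finsum_prod_eq_single _ a (fun p hp => if_neg fun h => hp (Option.some.inj h).symm)]
      simp only [if_true, Option.elim, extend_shift]

/-- The coproduct for which each letter is the sum of `a ⊗ 1`, of `1 ⊗ a` and of the `b ⊗ c` with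
`op b c = a` is dual to the quasi-shuffle product with contraction `op`. -/
theorem extend_eq_quasiCoproduct (op : A → A → Option A) (S : A → Finset (A × A))
    (hS : ∀ a p, p ∈ S a ↔ op p.1 p.2 = some a)
    (φ : A → MonoidAlgebra R (FreeMonoid A × FreeMonoid A)) (hφ : LocallyFinite φ)
    (hφS : ∀ a, φ a = mono R (FreeMonoid.of a, 1) + mono R (1, FreeMonoid.of a) +
      ∑ p ∈ S a, mono R (FreeMonoid.of p.1, FreeMonoid.of p.2)) (ψ : Series R A) :
    extend φ hφ ψ = quasiCoproduct R op ψ := by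
  classical
  suffices h : ∀ n (u v : FreeMonoid A), u.length + v.length ≤ n → ∀ ψ : Series R A,
      extend φ hφ ψ (u, v) = quasiCoproduct R op ψ (u, v) by
    ext p; exact h _ _ _ le_rfl ψ
  have hcoeff : ∀ (x : A) (P : MonoidAlgebra R (FreeMonoid A × FreeMonoid A))
      (m : FreeMonoid A × FreeMonoid A), (φ x * P).coeff m =
        (mono R ((FreeMonoid.of x, 1) : FreeMonoid A × FreeMonoid A) * P).coeff m +
        (mono R ((1, FreeMonoid.of x) : FreeMonoid A × FreeMonoid A) * P).coeff m +
        ∑ p ∈ S x, (mono R (FreeMonoid.of p.1, FreeMonoid.of p.2) * P).coeff m := by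
    intro x P m
    rw [hφS, add_mul, add_mul, sum_mul]
    simp [MonoidAlgebra.coeff_sum]
  -- In the coefficient at `a u ⊗ b v`, only the letter `a` contributes through `x ⊗ 1`, only `b`
  -- through `1 ⊗ x`, and only `op a b` through the remaining terms.
  have hl : ∀ (x a : A) (u v : FreeMonoid A) (P : MonoidAlgebra R (FreeMonoid A × FreeMonoid A)),
      (mono R ((FreeMonoid.of x, 1) : FreeMonoid A × FreeMonoid A) * P).coeff
        (FreeMonoid.of a * u, v) = if some a = some x then P.coeff (u, v) else 0 := by
    intro x a u v P
    split_ifs with h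
    · obtain rfl := Option.some.inj h
      exact (congrArg _ (by simp)).trans (coeff_mono_mul_mul (FreeMonoid.of a, 1) (u, v) P)
    · refine coeff_mono_mul_of_ne _ _ _ fun d hd => ?_
      exact of_mul_ne_of_mul (fun hxa => h (by rw [hxa])) _ _ (Prod.mk.inj hd).1
  have hr : ∀ (x b : A) (u v : FreeMonoid A) (P : MonoidAlgebra R (FreeMonoid A × FreeMonoid A)),
      (mono R ((1, FreeMonoid.of x) : FreeMonoid A × FreeMonoid A) * P).coeff
        (u, FreeMonoid.of b * v) = if some b = some x then P.coeff (u, v) else 0 := by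
    intro x b u v P
    split_ifs with h
    · obtain rfl := Option.some.inj h
      exact (congrArg _ (by simp)).trans (coeff_mono_mul_mul (1, FreeMonoid.of b) (u, v) P)
    · refine coeff_mono_mul_of_ne _ _ _ fun d hd => ?_
      exact of_mul_ne_of_mul (fun hxa => h (by rw [hxa])) _ _ (Prod.mk.inj hd).2
  have hl1 : ∀ (x : A) (v w : FreeMonoid A)
      (P : MonoidAlgebra R (FreeMonoid A × FreeMonoid A)),
      (mono R ((FreeMonoid.of x, w) : FreeMonoid A × FreeMonoid A) * P).coeff (1, v) = 0 := by
    intro x v w P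
    refine coeff_mono_mul_of_ne _ _ _ fun d hd => ?_
    exact List.cons_ne_nil _ _ (Prod.mk.inj hd).1
  have hr1 : ∀ (x : A) (v w : FreeMonoid A)
      (P : MonoidAlgebra R (FreeMonoid A × FreeMonoid A)),
      (mono R ((w, FreeMonoid.of x) : FreeMonoid A × FreeMonoid A) * P).coeff (v, 1) = 0 := by
    intro x v w P
    refine coeff_mono_mul_of_ne _ _ _ fun d hd => ?_
    exact List.cons_ne_nil _ _ (Prod.mk.inj hd).2
  have hm : ∀ (x a b : A) (u v : FreeMonoid A)
      (P : MonoidAlgebra R (FreeMonoid A × FreeMonoid A)),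
      ∑ p ∈ S x, (mono R (FreeMonoid.of p.1, FreeMonoid.of p.2) * P).coeff
        (FreeMonoid.of a * u, FreeMonoid.of b * v) =
          if op a b = some x then P.coeff (u, v) else 0 := by
    intro x a b u v P
    have h0 : ∀ p : A × A, p ≠ (a, b) →
        (mono R (FreeMonoid.of p.1, FreeMonoid.of p.2) * P).coeff
          (FreeMonoid.of a * u, FreeMonoid.of b * v) = 0 := by
      intro p hp
      refine coeff_mono_mul_of_ne _ _ _ fun d hd => hp ?_
      exact Prod.ext (List.cons.inj (Prod.mk.inj hd).1).1 (List.cons.inj (Prod.mk.inj hd).2).1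
    split_ifs with h
    · rw [Finset.sum_eq_single (a, b) (fun p _ hp => h0 p hp)
        (fun hn => absurd ((hS x (a, b)).2 h) hn)]
      exact coeff_mono_mul_mul (FreeMonoid.of a, FreeMonoid.of b) (u, v) P
    · refine sum_eq_zero fun p hp => h0 p ?_
      rintro rfl
      exact h ((hS x (a, b)).1 hp)
  have hone : ∀ m : FreeMonoid A × FreeMonoid A, m ≠ 1 →
      (1 : MonoidAlgebra R (FreeMonoid A × FreeMonoid A)).coeff m = 0 := by
    intro m hm
    simp [MonoidAlgebra.one_def, Ne.symm hm]
  intro n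
  induction n with
  | zero =>
    intro u v huv ψ
    obtain rfl : u = 1 := FreeMonoid.length_eq_zero.1 (by omega)
    obtain rfl : v = 1 := FreeMonoid.length_eq_zero.1 (by omega)
    rw [extend_apply_eq_finsum, quasiCoproduct_one_left, finsum_eq_zero_of_forall_eq_zero]
    · simp [MonoidAlgebra.one_def, ← Prod.one_eq_mk]
    · intro p
      rw [hcoeff, hl1, hr1, sum_eq_zero fun q _ => hl1 _ _ _ _]
      simp
  | succ n ih =>
    intro u v huv ψ
    rw [extend_apply_eq_finsum]
    induction u using FreeMonoid.casesOn with
    | one =>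
      induction v using FreeMonoid.casesOn with
      | one =>
        rw [← extend_apply_eq_finsum]
        exact ih 1 1 (by simp) ψ
      | of_mul b v =>
        have hz := finsum_ite_letter φ hφ ψ (some b) (1, v)
        rw [hone (1, FreeMonoid.of b * v) (fun h => List.cons_ne_nil _ _ (Prod.mk.inj h).2),
          mul_zero, zero_add, quasiCoproduct_one_left]
        refine Eq.trans (finsum_congr fun p => ?_) (hz.2.trans ?_)
        · rw [hcoeff, hl1, hr, sum_eq_zero fun q _ => hl1 _ _ _ _, zero_add, add_zero,
            mul_ite, mul_zero]
        · rw [Option.elim, ih _ _ (by simpa [add_comm] using huv), quasiCoproduct_one_left,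
            shift_apply]
    | of_mul a u =>
      induction v using FreeMonoid.casesOn with
      | one =>
        have hz := finsum_ite_letter φ hφ ψ (some a) (u, 1)
        rw [hone (FreeMonoid.of a * u, 1) (fun h => List.cons_ne_nil _ _ (Prod.mk.inj h).1),
          mul_zero, zero_add, quasiCoproduct_one_right]
        refine Eq.trans (finsum_congr fun p => ?_) (hz.2.trans ?_)
        · rw [hcoeff, hr1, hl, sum_eq_zero fun q _ => hr1 _ _ _ _, add_zero, add_zero,
            mul_ite, mul_zero]
        · rw [Option.elim, ih _ _ (by simpa [add_comm] using huv), quasiCoproduct_one_right,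
            shift_apply]
      | of_mul b v =>
        simp only [FreeMonoid.length_mul, FreeMonoid.length_of] at huv
        have h1 := finsum_ite_letter φ hφ ψ (some a) (u, FreeMonoid.of b * v)
        have h2 := finsum_ite_letter φ hφ ψ (some b) (FreeMonoid.of a * u, v)
        have h3 := finsum_ite_letter φ hφ ψ (op a b) (u, v)
        rw [hone (FreeMonoid.of a * u, FreeMonoid.of b * v)
          (fun h => List.cons_ne_nil _ _ (Prod.mk.inj h).1), mul_zero, zero_add,
          quasiCoproduct_of_mul]
        simp only [hcoeff, hl, hr, hm, mul_add, mul_ite, mul_zero]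
        rw [finsum_add_distrib ((h1.1.union h2.1).subset (Function.support_add _ _)) h3.1,
          finsum_add_distrib h1.1 h2.1, h1.2, h2.2, h3.2, Option.elim, Option.elim,
          ih u (FreeMonoid.of b * v) (by simp; omega),
          ih (FreeMonoid.of a * u) v (by simp; omega)]
        congr 1
        cases op a b with
        | none => rfl
        | some c => rw [Option.elim, Option.elim, ih _ _ (by omega)]

/-- The extension of `transform c` to the completed tensor square. -/
def transformTensor (c : B → A →₀ R) :
    (FreeMonoid A × FreeMonoid A → R) →ₗ[R] (FreeMonoid B × FreeMonoid B → R) where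
  toFun H p := transform c (fun u => transform c (fun v => H (u, v)) p.2) p.1
  map_add' H H' := funext fun p => congrFun ((congrArg (transform c) (funext fun u =>
    congrFun (map_add (transform c) (fun v => H (u, v)) fun v => H' (u, v)) p.2)).trans
      (map_add (transform c) _ _)) p.1
  map_smul' r H := funext fun p => congrFun ((congrArg (transform c) (funext fun u =>
    congrFun (map_smul (transform c) r fun v => H (u, v)) p.2)).trans
      (map_smul (transform c) r _)) p.1

theorem transformTensor_apply (c : B → A →₀ R) (H : FreeMonoid A × FreeMonoid A → R)
    (u v : FreeMonoid B) : transformTensor c H (u, v) =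
      transform c (fun u => transform c (fun v' => H (u, v')) v) u := rfl

theorem transformTensor_of_mul_left (c : B → A →₀ R) (H : FreeMonoid A × FreeMonoid A → R)
    (b : B) (u v : FreeMonoid B) :
    transformTensor c H (FreeMonoid.of b * u, v) = Finsupp.linearCombination R
      (fun a => transformTensor c (fun p => H (FreeMonoid.of a * p.1, p.2)) (u, v)) (c b) := by
  rw [transformTensor_apply, transform_apply_of_mul]
  rfl

theorem transformTensor_of_mul_right (c : B → A →₀ R) (H : FreeMonoid A × FreeMonoid A → R)
    (b : B) (u v : FreeMonoid B) :
    transformTensor c H (u, FreeMonoid.of b * v) = Finsupp.linearCombination R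
      (fun a => transformTensor c (fun p => H (p.1, FreeMonoid.of a * p.2)) (u, v)) (c b) := by
  rw [transformTensor_apply]
  have h : (fun u' => transform c (fun v' => H (u', v')) (FreeMonoid.of b * v)) =
      Finsupp.linearCombination R (fun a u' =>
        transform c (fun v' => H (u', FreeMonoid.of a * v')) v) (c b) := by
    ext u'
    rw [transform_apply_of_mul, Finsupp.linearCombination_apply, Finsupp.linearCombination_apply,
      Finsupp.sum, Finsupp.sum, Finset.sum_apply]
    rfl
  rw [h]
  exact Finsupp.apply_linearCombination R (LinearMap.proj u ∘ₗ transform c) _ _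

theorem transformTensor_injective (c : B → A →₀ R)
    (hc : Function.Injective (transform c : Series R A → Series R B)) :
    Function.Injective (transformTensor c) := by
  intro H H' h
  have h1 : ∀ v : FreeMonoid B, (fun u => transform c (fun v => H (u, v)) v) =
      fun u => transform c (fun v => H' (u, v)) v := fun v =>
    hc (funext fun u => congrFun h (u, v))
  ext ⟨u, v⟩
  have h2 : (fun v => H (u, v)) = fun v => H' (u, v) :=
    hc (funext fun v => congrFun (h1 v) u)
  exact congrFun h2 v

theorem transformTensor_primitivePart (c : B → A →₀ R) (f : Series R A) :
    transformTensor c (primitivePart R A f) = primitivePart R B (transform c f) := by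
  ext ⟨u, v⟩
  have h1 : ∀ x : FreeMonoid A, (fun v => primitivePart R A f (x, v)) =
      f x • one R A + one R A x • f := by
    intro x; ext y; simp [primitivePart, tensor]
  have h2 : (fun x => transform c (fun v => primitivePart R A f (x, v)) v) =
      one R B v • f + transform c f v • one R A := by
    ext x
    simp only [h1, map_add, map_smul, transform_one, Pi.add_apply, Pi.smul_apply, smul_eq_mul]
    ring
  rw [transformTensor_apply, h2]
  simp only [map_add, map_smul, transform_one, primitivePart, tensor, LinearMap.coe_mk,
    AddHom.coe_mk, Pi.add_apply, Pi.smul_apply, smul_eq_mul]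
  ring

/-- A substitution of letters is a morphism of coalgebras as soon as its matrix is compatible with
the contractions of pairs of letters. -/
theorem quasiCoproduct_transform (op : A → A → Option A) (op' : B → B → Option B)
    (c : B → A →₀ R)
    (hc : ∀ (h : A → R) (b b' : B),
      Finsupp.linearCombination R (fun a => Finsupp.linearCombination R
        (fun a' => (op a a').elim 0 h) (c b')) (c b) =
      (op' b b').elim 0 fun b'' => Finsupp.linearCombination R h (c b'')) (f : Series R A) :
    quasiCoproduct R op' (transform c f) = transformTensor c (quasiCoproduct R op f) := by
  ext ⟨u, v⟩
  -- By linearity, a combination of left quotients can be moved out of the coproduct.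
  have hlin : ∀ (f : Series R A) (b : B) (p : FreeMonoid B × FreeMonoid B),
      transformTensor c (quasiCoproduct R op
        (Finsupp.linearCombination R (fun a => shift (FreeMonoid.of a) f) (c b))) p =
      Finsupp.linearCombination R (fun a =>
        transformTensor c (quasiCoproduct R op (shift (FreeMonoid.of a) f)) p) (c b) :=
    fun f b p => Finsupp.apply_linearCombination R
      (LinearMap.proj p ∘ₗ transformTensor c ∘ₗ quasiCoproduct R op) _ _
  induction u using FreeMonoid.inductionOn' generalizing v f with
  | one =>
    rw [quasiCoproduct_one_left, transformTensor_apply, transform_apply_one]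
    simp only [quasiCoproduct_one_left]
  | of_mul b u ihu =>
    induction v using FreeMonoid.inductionOn' generalizing f with
    | one =>
      rw [quasiCoproduct_one_right, transformTensor_apply]
      simp only [transform_apply_one, quasiCoproduct_one_right]
    | of_mul b' v ihv =>
      rw [quasiCoproduct_of_mul]
      simp only [shift_transform, ihu, ihv, hlin]
      rw [← hc, transformTensor_of_mul_left]
      simp only [transformTensor_of_mul_right, transformTensor_of_mul_left]
      have hsplit : ∀ a a', (fun p : FreeMonoid A × FreeMonoid A =>
          quasiCoproduct R op f (FreeMonoid.of a * p.1, FreeMonoid.of a' * p.2)) =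
          (fun p => quasiCoproduct R op (shift (FreeMonoid.of a) f)
            (p.1, FreeMonoid.of a' * p.2)) +
          (fun p => quasiCoproduct R op (shift (FreeMonoid.of a') f)
            (FreeMonoid.of a * p.1, p.2)) +
          (op a a').elim 0 fun x => quasiCoproduct R op (shift (FreeMonoid.of x) f) := by
        intro a a'
        ext p
        rw [quasiCoproduct_of_mul]
        cases op a a' <;> rfl
      have helim : ∀ a a', transformTensor c ((op a a').elim 0 fun x =>
          quasiCoproduct R op (shift (FreeMonoid.of x) f)) (u, v) =
          (op a a').elim 0 fun x =>
            transformTensor c (quasiCoproduct R op (shift (FreeMonoid.of x) f)) (u, v) := by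
        intro a a'
        cases op a a' <;> simp
      simp only [hsplit, map_add, Pi.add_apply, helim]
      simp only [Finsupp.linearCombination_apply, Finsupp.sum, smul_add, sum_add_distrib]
      congr 2
      simp only [smul_sum]
      rw [sum_comm]
      exact sum_congr rfl fun a _ => sum_congr rfl fun a' _ => smul_comm _ _ _

theorem quasiCoproduct_transform_eq_iff (op : A → A → Option A) (op' : B → B → Option B)
    (c : B → A →₀ R) (hinj : Function.Injective (transform c : Series R A → Series R B))
    (hc : ∀ (h : A → R) (b b' : B),
      Finsupp.linearCombination R (fun a => Finsupp.linearCombination R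
        (fun a' => (op a a').elim 0 h) (c b')) (c b) =
      (op' b b').elim 0 fun b'' => Finsupp.linearCombination R h (c b'')) (f : Series R A) :
    quasiCoproduct R op' (transform c f) = primitivePart R B (transform c f) ↔
      quasiCoproduct R op f = primitivePart R A f := by
  rw [quasiCoproduct_transform op op' c hc, ← transformTensor_primitivePart]
  exact (transformTensor_injective c hinj).eq_iff

end QuasiShuffle

/-! ### Substitutions that only mix the indices of letters -/

section Kernel

variable {R I J L : Type*} [CommRing R] [Fintype I]

/-- The rows of the substitution `x₀ ↦ x₀`, `x_i ↦ ∑ j, k j i • x_j`. -/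
def xRow (k : Matrix J I R) : XLetter J → XLetter I →₀ R
  | none => Finsupp.single none 1
  | some j => ∑ i, Finsupp.single (some i) (k j i)

/-- The rows of the substitution `y_{n,i} ↦ ∑ j, k j i • y_{n,j}`. -/
def yRow (k : Matrix J I R) (y : YLetter J) : YLetter I →₀ R :=
  ∑ i, Finsupp.single (y.1, i) (k y.2 i)

/-- The continuous algebra morphism `x₀ ↦ x₀`, `x_i ↦ ∑ j, k j i • x_j`. -/
def xTransform (k : Matrix J I R) : Series R (XLetter I) →ₗ[R] Series R (XLetter J) :=
  transform (xRow k)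

/-- The continuous algebra morphism `y_{n,i} ↦ ∑ j, k j i • y_{n,j}`. -/
def yTransform (k : Matrix J I R) : Series R (YLetter I) →ₗ[R] Series R (YLetter J) :=
  transform (yRow k)

theorem xRow_some_some (k : Matrix J I R) (j : J) (i : I) : xRow k (some j) (some i) = k j i := by
  classical
  rw [xRow, Finsupp.finsetSum_apply, Finset.sum_eq_single i]
  · simp
  · intro i' _ hi'; simp [hi']
  · simp

theorem xRow_some_none (k : Matrix J I R) (j : J) : xRow k (some j) none = 0 := by
  simp [xRow, Finsupp.finsetSum_apply]

theorem xRow_none_some (k : Matrix J I R) (i : I) : xRow k none (some i) = 0 := by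
  simp [xRow]

theorem linearCombination_xRow_some {M : Type*} [AddCommGroup M] [Module R M] (k : Matrix J I R)
    (h : XLetter I → M) (j : J) :
    Finsupp.linearCombination R h (xRow k (some j)) = ∑ i, k j i • h (some i) := by
  simp [xRow]

theorem linearCombination_yRow {M : Type*} [AddCommGroup M] [Module R M] (k : Matrix J I R)
    (h : YLetter I → M) (y : YLetter J) :
    Finsupp.linearCombination R h (yRow k y) = ∑ i, k y.2 i • h (y.1, i) := by
  simp [yRow]

theorem xTransform_apply_one (k : Matrix J I R) (f : Series R (XLetter I)) :
    xTransform k f 1 = f 1 := rfl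

theorem xTransform_apply_none (k : Matrix J I R) (f : Series R (XLetter I))
    (w : FreeMonoid (XLetter J)) :
    xTransform k f (FreeMonoid.of none * w) = xTransform k (shift (FreeMonoid.of none) f) w := by
  rw [xTransform, transform_apply_of_mul, xRow, Finsupp.linearCombination_single, one_smul]

theorem xTransform_apply_some (k : Matrix J I R) (f : Series R (XLetter I)) (j : J)
    (w : FreeMonoid (XLetter J)) :
    xTransform k f (FreeMonoid.of (some j) * w) =
      ∑ i, k j i * xTransform k (shift (FreeMonoid.of (some i)) f) w := by
  rw [xTransform, transform_apply_of_mul, linearCombination_xRow_some]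
  rfl

theorem yTransform_apply_of_mul (k : Matrix J I R) (f : Series R (YLetter I)) (y : YLetter J)
    (w : FreeMonoid (YLetter J)) :
    yTransform k f (FreeMonoid.of y * w) =
      ∑ i, k y.2 i * yTransform k (shift (FreeMonoid.of (y.1, i)) f) w := by
  rw [yTransform, transform_apply_of_mul, linearCombination_yRow]
  rfl

theorem xTransform_xTransform [Fintype J] (k : Matrix L J R) (k' : Matrix J I R)
    (f : Series R (XLetter I)) :
    xTransform k (xTransform k' f) = xTransform (k * k') f := by
  rw [xTransform, xTransform, transform_transform, xTransform]
  congr 2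
  funext x
  cases x with
  | none => simp [xRow]
  | some l =>
    rw [linearCombination_xRow_some]
    simp only [xRow, smul_sum, Finsupp.smul_single, smul_eq_mul, Matrix.mul_apply,
      Finsupp.single_finsetSum]
    exact sum_comm

theorem yTransform_yTransform [Fintype J] (k : Matrix L J R) (k' : Matrix J I R)
    (f : Series R (YLetter I)) :
    yTransform k (yTransform k' f) = yTransform (k * k') f := by
  rw [yTransform, yTransform, transform_transform, yTransform]
  congr 2
  funext x
  rw [linearCombination_yRow]
  simp only [yRow, smul_sum, Finsupp.smul_single, smul_eq_mul, Matrix.mul_apply,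
    Finsupp.single_finsetSum]
  exact sum_comm

theorem xTransform_id [DecidableEq I] (f : Series R (XLetter I)) :
    xTransform (1 : Matrix I I R) f = f := by
  refine Eq.trans ?_ (transform_single f)
  rw [xTransform]
  congr 2
  funext x
  cases x with
  | none => rfl
  | some i =>
    rw [xRow, Finset.sum_eq_single i]
    · simp
    · intro j _ hj; simp [Matrix.one_apply_ne' hj]
    · simp

theorem yTransform_id [DecidableEq I] (f : Series R (YLetter I)) :
    yTransform (1 : Matrix I I R) f = f := by
  refine Eq.trans ?_ (transform_single f)
  rw [yTransform]
  congr 2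
  funext x
  rw [yRow, Finset.sum_eq_single x.2]
  · simp
  · intro j _ hj; simp [Matrix.one_apply_ne' hj]
  · simp

theorem xTransform_injective [Fintype J] [DecidableEq I] (k : Matrix J I R) (k' : Matrix I J R)
    (h : k' * k = 1) : Function.Injective (xTransform k) :=
  Function.LeftInverse.injective (g := xTransform k') fun f => by
    rw [xTransform_xTransform, h, xTransform_id]

theorem yTransform_injective [Fintype J] [DecidableEq I] (k : Matrix J I R) (k' : Matrix I J R)
    (h : k' * k = 1) : Function.Injective (yTransform k) :=
  Function.LeftInverse.injective (g := yTransform k') fun f => by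
    rw [yTransform_yTransform, h, yTransform_id]

/-- Substitutions commute with a change of coefficients along a ring morphism. -/
theorem map_xTransform {S : Type*} [CommRing S] (ρ : R →+* S) (k : Matrix J I R)
    (f : Series R (XLetter I)) (w : FreeMonoid (XLetter J)) :
    ρ (xTransform k f w) = xTransform (k.map ρ) (fun v => ρ (f v)) w := by
  induction w using FreeMonoid.inductionOn' generalizing f with
  | one => rfl
  | of_mul x w ih =>
    cases x with
    | none => rw [xTransform_apply_none, xTransform_apply_none, ih]; rfl
    | some j =>
      rw [xTransform_apply_some, xTransform_apply_some, map_sum]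
      refine sum_congr rfl fun i _ => ?_
      rw [map_mul, ih]
      rfl

theorem piY_xTransform (k : Matrix J I R) (f : Series R (XLetter I)) :
    piY R J (xTransform k f) = yTransform k (piY R I f) := by
  have hpow : ∀ (n : ℕ) (f : Series R (XLetter I)) (w : FreeMonoid (XLetter J)),
      xTransform k f (FreeMonoid.of none ^ n * w) =
        xTransform k (shift (FreeMonoid.of none ^ n) f) w := by
    intro n
    induction n with
    | zero => intro f w; simp only [pow_zero, one_mul]; rfl
    | succ n ih =>
      intro f w
      rw [pow_succ', mul_assoc, xTransform_apply_none, ih, ← shift_mul, ← pow_succ']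
  ext w
  change xTransform k f (yToX w) = _
  induction w using FreeMonoid.inductionOn' generalizing f with
  | one => rfl
  | of_mul y w ih =>
    rw [yTransform_apply_of_mul, map_mul]
    simp only [yToX, FreeMonoid.lift_eval_of, zeroPowThen] at ih ⊢
    rw [mul_assoc, hpow, xTransform_apply_some]
    refine sum_congr rfl fun i _ => ?_
    rw [ih, ← shift_mul]
    refine congrArg (fun g => k y.2 i * yTransform k g w) (funext fun v => ?_)
    simp [piY, shift_apply, yToX, zeroPowThen]

theorem xTransform_zeroPowThen (k : Matrix J I R) (f : Series R (XLetter I)) (n : ℕ) (j : J) :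
    xTransform k f (zeroPowThen n j) = ∑ i, k j i * f (zeroPowThen n i) := by
  induction n generalizing f with
  | zero =>
    simp only [zeroPowThen, pow_zero, one_mul]
    rw [← mul_one (FreeMonoid.of (some j)), xTransform_apply_some]
    simp [xTransform_apply_one, shift_apply]
  | succ n ih =>
    simp only [zeroPowThen] at ih ⊢
    rw [pow_succ', mul_assoc, xTransform_apply_none, ih]
    simp only [shift_apply, mul_assoc, pow_succ']

theorem xTransform_apply_of_none (k : Matrix J I R) (f : Series R (XLetter I)) :
    xTransform k f (FreeMonoid.of none) = f (FreeMonoid.of none) := by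
  rw [← mul_one (FreeMonoid.of none), xTransform_apply_none]
  simp [xTransform_apply_one, shift_apply]

theorem xTransform_apply_of_some (k : Matrix J I R) (f : Series R (XLetter I)) (j : J) :
    xTransform k f (FreeMonoid.of (some j)) = ∑ i, k j i * f (FreeMonoid.of (some i)) := by
  simpa [zeroPowThen] using xTransform_zeroPowThen k f 0 j

/-- The matrix of a map of indices. -/
def indexMatrix (R : Type*) [CommRing R] [DecidableEq J] (s : I → J) : Matrix J I R :=
  Matrix.of fun j i => if s i = j then 1 else 0

theorem rename_eq_xTransform [Fintype J] [DecidableEq J] (s : I → J) :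
    rename R (Option.map s) = xTransform (indexMatrix R s) := by
  ext1 f
  rw [rename, substitute_eq_transform, xTransform]
  congr 2
  funext x
  ext y
  cases x <;> cases y <;>
    simp [xRow_some_some, xRow_some_none, xRow_none_some, indexMatrix]
  simp [xRow]

end Kernel

/-! ### The discrete Fourier transform -/

section Fourier

variable {N : ℕ} {K : Type*} [Field K]

theorem pow_val_mul {x : K} (hx : x ^ N = 1) (a b : ZMod N) :
    x ^ (a * b).val = (x ^ a.val) ^ b.val := by
  rw [ZMod.val_mul, ← pow_mul]
  exact (pow_eq_pow_mod _ hx).symm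

theorem coe_pow_card (g : rootsOfUnity N K) : (((g : Kˣ) : K)) ^ N = 1 := by
  rw [← Units.val_pow_eq_pow_val, (mem_rootsOfUnity N _).1 g.2, Units.val_one]

variable (N K) in
/-- The matrix of `𝓕` on letters, the character table `(g, α) ↦ g^{-α}` of `ℤ/N`. -/
def fourier : Matrix (rootsOfUnity N K) (ZMod N) K :=
  Matrix.of fun g α => ((g : Kˣ) : K) ^ (-α).val

theorem fourier_apply (g : rootsOfUnity N K) (α : ZMod N) :
    fourier N K g α = ((g : Kˣ) : K) ^ (-α).val := rfl

theorem fourier_one (α : ZMod N) : fourier N K 1 α = 1 := by simp [fourier_apply]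

theorem fourier_mul (g h : rootsOfUnity N K) (α : ZMod N) :
    fourier N K (g * h) α = fourier N K g α * fourier N K h α := by
  simp [fourier_apply, mul_pow]

theorem fourier_zero (g : rootsOfUnity N K) : fourier N K g 0 = 1 := by simp [fourier_apply]

variable [NeZero N]

theorem pow_val_add {x : K} (hx : x ^ N = 1) (a b : ZMod N) :
    x ^ (a + b).val = x ^ a.val * x ^ b.val := by
  rw [ZMod.val_add, ← pow_add]
  exact (pow_eq_pow_mod _ hx).symm

theorem pow_val_neg_mul {x : K} (hx : x ^ N = 1) (a : ZMod N) : x ^ (-a).val * x ^ a.val = 1 := by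
  rw [← pow_val_add hx, neg_add_cancel, ZMod.val_zero, pow_zero]

/-- Orthogonality of characters of `ℤ/N`. -/
theorem sum_pow_val {x : K} (hx : x ^ N = 1) [DecidableEq K] :
    ∑ a : ZMod N, x ^ a.val = if x = 1 then (N : K) else 0 := by
  have h : ∑ a : ZMod N, x ^ a.val = ∑ i ∈ range N, x ^ i :=
    Finset.sum_bij (fun a _ => a.val) (fun a _ => mem_range.2 (ZMod.val_lt a))
      (fun a _ b _ hab => ZMod.val_injective N hab)
      (fun i hi => ⟨(i : ZMod N), mem_univ _, ZMod.val_cast_of_lt (mem_range.1 hi)⟩)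
      fun _ _ => rfl
  rw [h]
  split_ifs with h1
  · simp [h1]
  · refine eq_zero_of_ne_zero_of_mul_right_eq_zero (sub_ne_zero.2 h1) ?_
    rw [geom_sum_mul, hx, sub_self]

variable (N K) in
/-- The inverse matrix `(α, g) ↦ g^α / N`. -/
def fourierInv : Matrix (ZMod N) (rootsOfUnity N K) K :=
  Matrix.of fun α g => (N : K)⁻¹ * ((g : Kˣ) : K) ^ α.val

theorem fourier_add (g : rootsOfUnity N K) (α β : ZMod N) :
    fourier N K g (α + β) = fourier N K g α * fourier N K g β := by
  rw [fourier_apply, neg_add, pow_val_add (coe_pow_card g)]; rfl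

theorem fourier_inv (g : rootsOfUnity N K) (α : ZMod N) :
    fourier N K g⁻¹ α = fourier N K g (-α) := by
  have h1 : fourier N K g⁻¹ α * fourier N K g α = 1 := by
    rw [← fourier_mul, inv_mul_cancel, fourier_one]
  have h2 : fourier N K g (-α) * fourier N K g α = 1 := by
    rw [← fourier_add, neg_add_cancel, fourier_zero]
  exact mul_right_cancel₀ (right_ne_zero_of_mul_eq_one h1) (h1.trans h2.symm)

theorem sum_fourier [DecidableEq (rootsOfUnity N K)] (g : rootsOfUnity N K) :
    ∑ α, fourier N K g α = if g = 1 then (N : K) else 0 := by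
  classical
  have h : ∑ α, fourier N K g α = ∑ α : ZMod N, ((g : Kˣ) : K) ^ α.val :=
    Equiv.sum_comp (Equiv.neg (ZMod N)) fun α : ZMod N => ((g : Kˣ) : K) ^ α.val
  rw [h, sum_pow_val (coe_pow_card g)]
  congr 1
  simp

variable {ζ : K}

theorem coe_toRootsOfUnity_pow (hζ : IsPrimitiveRoot ζ N) (n : ℕ) :
    ((hζ.toRootsOfUnity ^ n : rootsOfUnity N K) : Kˣ) = (ζ ^ n : K) := by
  simp [IsPrimitiveRoot.val_toRootsOfUnity_coe]

theorem card_roots (hζ : IsPrimitiveRoot ζ N) : Fintype.card (rootsOfUnity N K) = N := by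
  rw [← Nat.card_eq_fintype_card, hζ.card_rootsOfUnity]

/-- The powers of a primitive root of unity are indexed by the classes modulo `N`. -/
theorem bijective_toRootsOfUnity_pow (hζ : IsPrimitiveRoot ζ N) :
    Function.Bijective fun m : ZMod N => hζ.toRootsOfUnity ^ m.val := by
  rw [Fintype.bijective_iff_injective_and_card, ZMod.card, card_roots hζ]
  refine ⟨fun a b hab => ZMod.val_injective N ?_, rfl⟩
  refine hζ.pow_inj (ZMod.val_lt a) (ZMod.val_lt b) ?_
  rw [← coe_toRootsOfUnity_pow hζ, ← coe_toRootsOfUnity_pow hζ]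
  exact congrArg (fun g : rootsOfUnity N K => ((g : Kˣ) : K)) hab

theorem fourier_toRootsOfUnity_pow (hζ : IsPrimitiveRoot ζ N) (m α : ZMod N) :
    fourier N K (hζ.toRootsOfUnity ^ m.val) α = ζ ^ (-(m * α)).val := by
  rw [fourier_apply, coe_toRootsOfUnity_pow, ← pow_val_mul hζ.pow_eq_one, mul_neg]

theorem fourier_mul_fourierInv (hζ : IsPrimitiveRoot ζ N) [DecidableEq (rootsOfUnity N K)] :
    fourier N K * fourierInv N K = 1 := by
  have hN : (N : K) ≠ 0 := hζ.neZero'.out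
  ext g h
  have hα : ∀ α, fourier N K g α * fourierInv N K α h =
      (N : K)⁻¹ * fourier N K (g * h⁻¹) α := by
    intro α
    rw [fourier_mul, fourier_inv, fourier_apply h, neg_neg, fourierInv, Matrix.of_apply]
    ring
  rw [Matrix.mul_apply, sum_congr rfl fun α _ => hα α, ← mul_sum, sum_fourier, Matrix.one_apply]
  simp only [mul_inv_eq_one]
  split_ifs
  · exact inv_mul_cancel₀ hN
  · exact mul_zero _

theorem fourierInv_mul_fourier (hζ : IsPrimitiveRoot ζ N) : fourierInv N K * fourier N K = 1 := by
  classical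
  exact (Matrix.mul_eq_one_comm_of_card_eq _ _ _ ((card_roots hζ).trans (ZMod.card N).symm)).1
    (fourier_mul_fourierInv hζ)

theorem extend_congr {R A M : Type*} [CommRing R] [Monoid M] {φ φ' : A → MonoidAlgebra R M}
    (h : φ = φ') (hφ : LocallyFinite φ) (hφ' : LocallyFinite φ') :
    extend φ hφ = extend φ' hφ' := by
  subst h; rfl

theorem F_eq_xTransform (hζ : IsPrimitiveRoot ζ N) : F hζ = xTransform (fourier N K) := by
  let c : XLetter (ZMod N) → XLetter (rootsOfUnity N K) → K
    | none, none => 1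
    | some α, some g => fourier N K g α
    | _, _ => 0
  have hc : F hζ = substitute c := by
    refine extend_congr (funext fun a => ?_) _ _
    cases a with
    | none => simp [linearLetter, c, Fintype.sum_option]
    | some α =>
      simp only [linearLetter, c, Fintype.sum_option, zero_smul, zero_add]
      rw [← (bijective_toRootsOfUnity_pow hζ).sum_comp]
      simp only [fourier_toRootsOfUnity_pow hζ]
  ext1 f
  rw [hc, substitute_eq_transform, xTransform]
  congr 2
  funext x
  ext y
  cases x <;> cases y <;> simp [xRow_some_some, xRow_some_none, xRow_none_some, c]
  simp [xRow]

theorem F_injective (hζ : IsPrimitiveRoot ζ N) : Function.Injective (F hζ) := by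
  classical
  rw [F_eq_xTransform]
  exact xTransform_injective _ _ (fourierInv_mul_fourier hζ)

theorem F_xTransform_fourierInv (hζ : IsPrimitiveRoot ζ N)
    (f : Series K (XLetter (rootsOfUnity N K))) :
    F hζ (xTransform (fourierInv N K) f) = f := by
  classical
  rw [F_eq_xTransform, xTransform_xTransform, fourier_mul_fourierInv hζ, xTransform_id]

theorem tTilde_eq_xTransform (z : K) (m : ZMod N) :
    tTilde z m = xTransform (Matrix.diagonal fun α => z ^ (m * α).val) := by
  classical
  ext1 f
  rw [tTilde, substitute_eq_transform, xTransform]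
  congr 2
  funext x
  ext y
  cases x <;> cases y <;>
    simp [xRow_some_some, xRow_some_none, xRow_none_some, Matrix.diagonal_apply, eq_comm]
  · simp [xRow]
  · split_ifs with h
    · rw [h]
    · rfl

/-- Under `𝓕`, the automorphism `t̃_m` corresponds to `t_{ζ^m}`. -/
theorem F_tTilde (hζ : IsPrimitiveRoot ζ N) (m : ZMod N) (f : Series K (XLetter (ZMod N))) :
    F hζ (tTilde ζ m f) = t K (hζ.toRootsOfUnity ^ m.val) (F hζ f) := by
  classical
  rw [t, rename_eq_xTransform, F_eq_xTransform, tTilde_eq_xTransform, xTransform_xTransform,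
    xTransform_xTransform]
  congr 2
  ext g α
  obtain ⟨h, rfl⟩ := (Group.mulLeft_bijective (hζ.toRootsOfUnity ^ m.val)).surjective g
  rw [Matrix.mul_diagonal, Matrix.mul_apply, Finset.sum_eq_single h]
  · rw [fourier_mul, fourier_toRootsOfUnity_pow, indexMatrix, Matrix.of_apply, if_pos rfl, one_mul,
      mul_right_comm, pow_val_neg_mul hζ.pow_eq_one, one_mul]
  · intro h' _ hh'
    rw [indexMatrix, Matrix.of_apply, if_neg, zero_mul]
    exact fun h2 => hh' (mul_left_cancel h2)
  · simp

end Fourier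

/-! ### The harmonic and shuffle coproducts as quasi-shuffle coproducts -/

section Coproducts

variable {R : Type*}

/-- The contraction of letters for which the quasi-shuffle product is the shuffle product. -/
def shuffleOp {A : Type*} (_ _ : A) : Option A := none

/-- The contraction `y_{k,g}, y_{l,h} ↦ y_{k+l,gh}`. -/
def harmonicOp {G : Type*} [Mul G] (y z : YLetter G) : Option (YLetter G) :=
  some (y.1 + z.1, y.2 * z.2)

/-- The contraction `y_{k,α}, y_{l,α} ↦ y_{k+l,α}`. -/
def congruentOp {I : Type*} [DecidableEq I] (y z : YLetter I) : Option (YLetter I) :=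
  if y.2 = z.2 then some (y.1 + z.1, y.2) else none

theorem mem_splittings (k : ℕ+) (p : ℕ+ × ℕ+) : p ∈ splittings k ↔ p.1 + p.2 = k := by
  simp only [splittings, mem_filter, mem_product, mem_Iio, and_iff_right_iff_imp]
  rintro rfl
  exact ⟨PNat.lt_add_right _ _, PNat.lt_add_left _ _⟩

theorem shuffleCoproduct_eq [CommRing R] {A : Type*} [Finite A] (ψ : Series R A) :
    shuffleCoproduct R A ψ = quasiCoproduct R shuffleOp ψ :=
  extend_eq_quasiCoproduct _ (fun _ => ∅) (fun a p => by simp [shuffleOp]) _ _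
    (fun a => by simp [shuffleLetter]) ψ

theorem harmonicCoproduct_eq [Field R] {G : Type*} [CommGroup G] [Fintype G]
    (ψ : Series R (YLetter G)) : harmonicCoproduct R G ψ = quasiCoproduct R harmonicOp ψ := by
  refine extend_eq_quasiCoproduct _ (harmonicPairs G) (fun a p => ?_) _ _ (fun _ => rfl) ψ
  simp only [harmonicPairs, mem_image, mem_product, mem_splittings, mem_filter, mem_univ,
    true_and, harmonicOp, Option.some.injEq]
  constructor
  · rintro ⟨q, ⟨h1, h2⟩, rfl⟩
    exact Prod.ext h1 h2
  · rintro rfl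
    exact ⟨((p.1.1, p.2.1), (p.1.2, p.2.2)), ⟨rfl, rfl⟩, rfl⟩

theorem congruentHarmonicCoproduct_eq [Field R] {N : ℕ} [NeZero N]
    (ψ : Series R (YLetter (ZMod N))) :
    congruentHarmonicCoproduct R N ψ = quasiCoproduct R congruentOp ψ := by
  refine extend_eq_quasiCoproduct _ (congruentPairs N) (fun a p => ?_) _ _ (fun _ => rfl) ψ
  simp only [congruentPairs, mem_image, mem_splittings, congruentOp]
  constructor
  · rintro ⟨q, h1, rfl⟩
    simp [h1]
  · intro h
    split_ifs at h with h2
    obtain rfl := Option.some.inj h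
    exact ⟨(p.1.1, p.2.1), rfl, Prod.ext rfl (Prod.ext rfl h2)⟩

end Coproducts

/-! ### Comparison of the two double shuffle Lie algebras over `K` -/

section Comparison

variable {N : ℕ} [NeZero N] {K : Type*} [Field K]

/-- The Fourier transform carries `𝐪⁻¹` to `𝐩⁻¹`.  For the induction the partial products start
at an arbitrary `g`: this produces the factor `g^{-α}`, where `α` is the sum of the successive
differences, that is, the first index. -/
theorem xTransform_fourier_partialProducts (g : rootsOfUnity N K)
    (f : Series K (XLetter (ZMod N))) (w : FreeMonoid (XLetter (rootsOfUnity N K))) :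
    xTransform (fourier N K) f (FreeMonoid.ofList (partialProducts g w.toList)) =
      xTransform (fourier N K) (fun v => fourier N K g (firstIndex v.toList) *
        f (FreeMonoid.ofList (successiveDifferences v.toList))) w := by
  induction w using FreeMonoid.inductionOn' generalizing g f with
  | one =>
    change f 1 = fourier N K g 0 * f 1
    rw [fourier_zero, one_mul]
  | of_mul x w ih =>
    cases x with
    | none =>
      rw [FreeMonoid.toList_of_mul, partialProducts, FreeMonoid.ofList_cons,
        xTransform_apply_none, xTransform_apply_none, ih]
      rfl
    | some h =>
      rw [FreeMonoid.toList_of_mul, partialProducts, FreeMonoid.ofList_cons,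
        xTransform_apply_some, xTransform_apply_some]
      simp only [ih]
      have hlin : ∀ (c : ZMod N → K) (e : ZMod N → Series K (XLetter (ZMod N))),
          ∑ α, c α * xTransform (fourier N K) (e α) w =
            xTransform (fourier N K) (∑ α, c α • e α) w := by
        intro c e
        simp only [map_sum, map_smul, Finset.sum_apply, Pi.smul_apply, smul_eq_mul]
      rw [hlin, hlin]
      refine congrArg (fun e => xTransform (fourier N K) e w) (funext fun v => ?_)
      simp only [Finset.sum_apply, Pi.smul_apply, smul_eq_mul, shift_apply,
        FreeMonoid.toList_of_mul, firstIndex, successiveDifferences, FreeMonoid.ofList_cons]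
      rw [← Equiv.sum_comp (Equiv.subRight (firstIndex v.toList))]
      refine sum_congr rfl fun α _ => ?_
      rw [Equiv.subRight_apply, ← mul_assoc, ← fourier_add, sub_add_cancel, fourier_mul]
      ring

theorem pInv_xTransform_fourier (f : Series K (XLetter (ZMod N))) :
    pInv K (rootsOfUnity N K) (xTransform (fourier N K) f) =
      xTransform (fourier N K) (qInv K N f) := by
  ext w
  refine (xTransform_fourier_partialProducts 1 f w).trans ?_
  simp only [fourier_one, one_mul]
  rfl

/-- The Fourier transform of a function of the length, supported on the words in the letters
`y_{1,β}`, is supported on the powers of `y_{1,1}`. -/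
theorem yTransform_fourier_of_length (H : ℕ → K) (w : FreeMonoid (YLetter (rootsOfUnity N K)))
    [DecidableEq (rootsOfUnity N K)] :
    yTransform (fourier N K)
      (fun v : FreeMonoid (YLetter (ZMod N)) => if ∀ y ∈ v.toList, y.1 = 1 then H v.length else 0)
        w = if ∀ y ∈ w.toList, y = (1, 1) then (N : K) ^ w.length * H w.length else 0 := by
  induction w using FreeMonoid.inductionOn' generalizing H with
  | one => simp [yTransform, transform_apply_one]
  | of_mul y w ih =>
    have hs : ∀ i : ZMod N, shift (FreeMonoid.of (y.1, i)) (fun v : FreeMonoid (YLetter (ZMod N)) =>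
        if ∀ y ∈ v.toList, y.1 = 1 then H v.length else 0) = (if y.1 = 1 then (1 : K) else 0) •
        fun v => if ∀ y ∈ v.toList, y.1 = 1 then H (v.length + 1) else 0 := by
      intro i
      ext v
      simp only [shift_apply, FreeMonoid.toList_of_mul, List.forall_mem_cons, ite_and,
        FreeMonoid.length_mul, FreeMonoid.length_of, add_comm 1, Pi.smul_apply, smul_eq_mul,
        ite_mul, one_mul, zero_mul]
    rw [yTransform_apply_of_mul]
    simp only [hs, map_smul, Pi.smul_apply, smul_eq_mul, ih (fun n => H (n + 1))]
    rw [← sum_mul, sum_fourier]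
    simp only [FreeMonoid.toList_of_mul, List.forall_mem_cons, FreeMonoid.length_mul,
      FreeMonoid.length_of, add_comm 1, Prod.ext_iff, ite_and, pow_succ]
    obtain ⟨k, g⟩ := y
    by_cases h1 : k = 1 <;> by_cases h2 : g = 1 <;> simp [h1, h2]
    split_ifs <;> ring

theorem eq_of_pow_length_iff {A : Type*} (a : A) (w : FreeMonoid A) :
    w = FreeMonoid.of a ^ w.length ↔ ∀ y ∈ w.toList, y = a := by
  induction w using FreeMonoid.inductionOn' with
  | one => simp
  | of_mul x w ih =>
    rw [FreeMonoid.length_mul, FreeMonoid.length_of, add_comm, pow_succ',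
      FreeMonoid.toList_of_mul, List.forall_mem_cons, ← ih]
    exact List.cons_eq_cons

theorem correction_xTransform_fourier (hN : (N : K) ≠ 0) (f : Series K (XLetter (ZMod N))) :
    correction K (rootsOfUnity N K) (xTransform (fourier N K) f) =
      yTransform (fourier N K) (congruentCorrection K N f) := by
  classical
  ext w
  refine Eq.trans ?_ ((yTransform_fourier_of_length (fun n => if 2 ≤ n then
    ∑ α : ZMod N, (-1) ^ (n - 1) / ((n : K) * (N : K) ^ n) * f (zeroPowThen (n - 1) α) else 0)
    w).symm.trans (congrArg (fun e => yTransform (fourier N K) e w) ?_))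
  · simp only [correction, LinearMap.coe_mk, AddHom.coe_mk, eq_of_pow_length_iff,
      xTransform_zeroPowThen, fourier_one, one_mul, and_comm (a := 2 ≤ _), ite_and]
    split_ifs
    · rw [mul_sum, mul_sum]
      refine sum_congr rfl fun α _ => ?_
      have := pow_ne_zero w.length hN
      rw [← mul_assoc, mul_div_assoc', mul_comm ((w.length : K)), mul_div_mul_left _ _ this]
    · simp
    · rfl
  · ext v
    simp only [congruentCorrection, LinearMap.coe_mk, AddHom.coe_mk, and_comm (a := 2 ≤ _), ite_and]

theorem star_xTransform_fourier (hN : (N : K) ≠ 0) (f : Series K (XLetter (ZMod N))) :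
    star K (rootsOfUnity N K) (xTransform (fourier N K) f) =
      yTransform (fourier N K) (congruentStar K N f) := by
  simp only [star, congruentStar, LinearMap.add_apply, LinearMap.comp_apply, map_add,
    pInv_xTransform_fourier, piY_xTransform, correction_xTransform_fourier hN]

/-- Over `K`, the map `𝓕` identifies the two double shuffle Lie algebras. -/
theorem F_mem_dmrGroup_iff {ζ : K} (hζ : IsPrimitiveRoot ζ N) (f : Series K (XLetter (ZMod N))) :
    F hζ f ∈ dmrGroup K (rootsOfUnity N K) ↔ f ∈ dmrCongruent K N := by
  classical
  have hinv := fourierInv_mul_fourier hζ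
  have hsh := quasiCoproduct_transform_eq_iff shuffleOp shuffleOp (xRow (fourier N K))
    (xTransform_injective _ _ hinv) (fun h b b' => by
      simp [shuffleOp, Finsupp.linearCombination_apply]) f
  have hst := quasiCoproduct_transform_eq_iff congruentOp harmonicOp (yRow (fourier N K))
    (yTransform_injective _ _ hinv) (fun h b b' => by
      simp only [linearCombination_yRow, harmonicOp, congruentOp, Option.elim_some, fourier_mul,
        smul_eq_mul]
      refine sum_congr rfl fun α _ => ?_
      rw [Finset.sum_eq_single α]
      · simp [mul_assoc]
      · intro β _ hβ; simp [hβ.symm]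
      · simp) (congruentStar K N f)
  have hsym : (∀ g : rootsOfUnity N K, xTransform (fourier N K) f (FreeMonoid.of (some g)) -
      xTransform (fourier N K) f (FreeMonoid.of (some g⁻¹)) = 0) ↔
      ∀ α : ZMod N, f (FreeMonoid.of (some α)) - f (FreeMonoid.of (some (-α))) = 0 := by
    let u : ZMod N → K := fun α => f (FreeMonoid.of (some α)) - f (FreeMonoid.of (some (-α)))
    have hu : ∀ g : rootsOfUnity N K, xTransform (fourier N K) f (FreeMonoid.of (some g)) -
        xTransform (fourier N K) f (FreeMonoid.of (some g⁻¹)) = (fourier N K).mulVec u g := by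
      intro g
      rw [xTransform_apply_of_some, xTransform_apply_of_some, Matrix.mulVec, dotProduct]
      simp only [u, mul_sub, sum_sub_distrib, fourier_inv]
      congr 1
      rw [← Equiv.sum_comp (Equiv.neg _)]
      simp
    have hker : (fourier N K).mulVec u = 0 ↔ u = 0 := by
      constructor
      · intro h
        rw [← Matrix.one_mulVec u, ← hinv, ← Matrix.mulVec_mulVec, h, Matrix.mulVec_zero]
      · intro h; rw [h, Matrix.mulVec_zero]
    simp only [hu]
    exact (funext_iff.symm.trans hker).trans funext_iff
  have hone : xTransform (fourier N K) f (FreeMonoid.of (some 1)) =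
      ∑ α, f (FreeMonoid.of (some α)) := by
    simp [xTransform_apply_of_some, fourier_one]
  have hN : (N : K) ≠ 0 := hζ.neZero'.out
  rw [F_eq_xTransform]
  change (_ ∧ _) ∧ _ ∧ _ ∧ _ ↔ (_ ∧ _) ∧ _ ∧ _ ∧ _
  rw [shuffleCoproduct_eq, shuffleCoproduct_eq, harmonicCoproduct_eq,
    congruentHarmonicCoproduct_eq, star_xTransform_fourier hN, hone, xTransform_apply_of_none, hsym]
  exact and_congr_right' (and_congr hsh (and_congr_right' hst))

end Comparison

/-! ### Rational structures -/

section Rational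

variable {A B R : Type*}

/-- A subspace of series is cut out by a family of finite rational combinations of coefficients.
The family makes sense over every field of characteristic zero, so that spaces over different
fields can be cut out by the same family. -/
def CutOut [Field R] [Algebra ℚ R] (Λ : Set (FreeMonoid A →₀ ℚ))
    (V : Submodule R (Series R A)) : Prop :=
  ∀ f, f ∈ V ↔ ∀ l ∈ Λ, Finsupp.linearCombination ℚ f l = 0

theorem baseChange_mem_iff {K : Type*} [Field K] [Algebra ℚ K] {Λ : Set (FreeMonoid A →₀ ℚ)}
    {V : Submodule ℚ (Series ℚ A)} {W : Submodule K (Series K A)} (hV : CutOut Λ V)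
    (hW : CutOut Λ W) (f : Series ℚ A) : baseChange K A f ∈ W ↔ f ∈ V := by
  rw [hV, hW]
  refine forall₂_congr fun l _ => ?_
  have h : Finsupp.linearCombination ℚ (baseChange K A f) l =
      algebraMap ℚ K (Finsupp.linearCombination ℚ f l) :=
    (Finsupp.apply_linearCombination ℚ (Algebra.linearMap ℚ K) f l).symm
  rw [h, map_eq_zero_iff _ (algebraMap ℚ K).injective]

/-- If `V` and `W` are cut out by the same family, then `K ⊗̂ V = W`: the coordinates of an element
of `W` in a basis of `K` over `ℚ` belong to `V`, and conversely each of the equations of `W` only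
involves words of bounded length. -/
theorem completedTensor_eq {K : Type*} [Field K] [Algebra ℚ K] [FiniteDimensional ℚ K]
    {Λ : Set (FreeMonoid A →₀ ℚ)} {V : Submodule ℚ (Series ℚ A)} {W : Submodule K (Series K A)}
    (hV : CutOut Λ V) (hW : CutOut Λ W) : completedTensor K V = W := by
  apply le_antisymm
  · intro f hf
    have hspan : Submodule.span K (baseChange K A '' V) ≤ W := by
      rw [Submodule.span_le]
      rintro _ ⟨g, hg, rfl⟩
      exact (baseChange_mem_iff hV hW g).2 hg
    rw [hW]
    intro l hl
    obtain ⟨g, hg, hfg⟩ := hf (l.support.sup FreeMonoid.length)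
    rw [← (hW g).1 (hspan hg) l hl, Finsupp.linearCombination_apply,
      Finsupp.linearCombination_apply]
    refine Finset.sum_congr rfl fun w hw => ?_
    simp only [hfg w (le_sup (f := FreeMonoid.length) hw)]
  · intro f hf n
    refine ⟨f, ?_, fun _ _ => rfl⟩
    let b := Module.finBasis ℚ K
    have hcoord : ∀ i, (fun w => b.coord i (f w)) ∈ V := by
      intro i
      rw [hV]
      intro l hl
      have h := Finsupp.apply_linearCombination ℚ (b.coord i) f l
      rw [(hW f).1 hf l hl, map_zero] at h
      exact h.symm
    have hsum : f = ∑ i, b i • baseChange K A (fun w => b.coord i (f w)) := by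
      ext w
      rw [Finset.sum_apply]
      conv_lhs => rw [← b.sum_repr (f w)]
      refine sum_congr rfl fun i _ => ?_
      rw [Algebra.smul_def, mul_comm]
      rfl
    rw [hsum]
    exact Submodule.sum_mem _ fun i _ =>
      Submodule.smul_mem _ _ (Submodule.subset_span ⟨_, hcoord i, rfl⟩)

open scoped Classical in
/-- The functionals that express that the series whose coefficients are the functionals `D w` is
primitive for a quasi-shuffle coproduct. -/
def primitivityEquation (op : B → B → Option B) (D : FreeMonoid B → FreeMonoid A →₀ ℚ)
    (p : FreeMonoid B × FreeMonoid B) : FreeMonoid A →₀ ℚ :=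
  ((quasiShuffle op p.1.toList p.2.toList).map D).sum -
    ((if p.2 = 1 then D p.1 else 0) + if p.1 = 1 then D p.2 else 0)

theorem primitivityEquation_iff [Field R] [Algebra ℚ R] (op : B → B → Option B)
    (D : FreeMonoid B → FreeMonoid A →₀ ℚ) (f : Series R A) (h : Series R B)
    (hD : ∀ w, Finsupp.linearCombination ℚ f (D w) = h w) :
    quasiCoproduct R op h = primitivePart R B h ↔
      ∀ p, Finsupp.linearCombination ℚ f (primitivityEquation op D p) = 0 := by
  rw [funext_iff]
  refine forall_congr' fun p => ?_
  have h1 : Finsupp.linearCombination ℚ f (primitivityEquation op D p) =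
      quasiCoproduct R op h p - primitivePart R B h p := by
    have hm : ∀ s : Multiset (FreeMonoid B),
        Finsupp.linearCombination ℚ f (s.map D).sum = (s.map h).sum := by
      intro s
      rw [map_multiset_sum, Multiset.map_map]
      exact congrArg _ (Multiset.map_congr rfl fun w _ => hD w)
    rw [primitivityEquation, map_sub, map_add, hm, apply_ite (Finsupp.linearCombination ℚ f),
      apply_ite (Finsupp.linearCombination ℚ f), hD, hD, map_zero]
    simp [quasiCoproduct, primitivePart, tensor, one, Pi.single_apply]
  rw [h1, sub_eq_zero]

open scoped Classical in
/-- The coefficients of `ψ_*` as rational combinations of the coefficients of `ψ`, for a group. -/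
def starDual (G : Type*) [CommGroup G] (w : FreeMonoid (YLetter G)) :
    FreeMonoid (XLetter G) →₀ ℚ :=
  Finsupp.single (FreeMonoid.ofList (partialProducts 1 (yToX w).toList)) 1 +
    if 2 ≤ w.length ∧ w = FreeMonoid.of ((1 : ℕ+), (1 : G)) ^ w.length then
      Finsupp.single (zeroPowThen (w.length - 1) 1) ((-1) ^ (w.length - 1) / (w.length : ℚ))
    else 0

open scoped Classical in
/-- The coefficients of `ψ_*` as rational combinations of the coefficients of `ψ`, for congruence
classes. -/
def congruentStarDual (N : ℕ) [NeZero N] (w : FreeMonoid (YLetter (ZMod N))) :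
    FreeMonoid (XLetter (ZMod N)) →₀ ℚ :=
  Finsupp.single (FreeMonoid.ofList (successiveDifferences (yToX w).toList)) 1 +
    if 2 ≤ w.length ∧ ∀ y ∈ w.toList, y.1 = 1 then
      ∑ α : ZMod N, Finsupp.single (zeroPowThen (w.length - 1) α)
        ((-1) ^ (w.length - 1) / ((w.length : ℚ) * (N : ℚ) ^ w.length))
    else 0

theorem linearCombination_starDual [Field R] [Algebra ℚ R] (G : Type*) [CommGroup G] [Fintype G]
    (f : Series R (XLetter G)) (w : FreeMonoid (YLetter G)) :
    Finsupp.linearCombination ℚ f (starDual G w) = star R G f w := by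
  simp only [starDual, star, map_add, apply_ite (Finsupp.linearCombination ℚ f), map_zero,
    Finsupp.linearCombination_single, one_mul, LinearMap.add_apply, LinearMap.comp_apply,
    Pi.add_apply, Algebra.smul_def, map_div₀, map_pow, map_neg, map_one, map_natCast]
  rfl

theorem linearCombination_congruentStarDual [Field R] [Algebra ℚ R] (N : ℕ) [NeZero N]
    (f : Series R (XLetter (ZMod N))) (w : FreeMonoid (YLetter (ZMod N))) :
    Finsupp.linearCombination ℚ f (congruentStarDual N w) = congruentStar R N f w := by
  simp only [congruentStarDual, congruentStar, map_add, apply_ite (Finsupp.linearCombination ℚ f),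
    map_zero, map_sum, Finsupp.linearCombination_single, one_mul, LinearMap.add_apply,
    LinearMap.comp_apply, Pi.add_apply, Algebra.smul_def, map_div₀, map_pow, map_neg, map_one,
    map_natCast, map_mul]
  rfl

/-- The rational equations of the double shuffle Lie algebra of a finite abelian group. -/
def groupEquations (G : Type*) [CommGroup G] : Set (FreeMonoid (XLetter G) →₀ ℚ) :=
  {Finsupp.single (FreeMonoid.of none) 1, Finsupp.single (FreeMonoid.of (some 1)) 1} ∪
    Set.range (primitivityEquation shuffleOp fun w => Finsupp.single w 1) ∪
    Set.range (fun g : G => Finsupp.single (FreeMonoid.of (some g)) 1 -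
      Finsupp.single (FreeMonoid.of (some g⁻¹)) 1) ∪
    Set.range (primitivityEquation harmonicOp (starDual G))

/-- The rational equations of the congruent double shuffle Lie algebra. -/
def congruentEquations (N : ℕ) [NeZero N] : Set (FreeMonoid (XLetter (ZMod N)) →₀ ℚ) :=
  {Finsupp.single (FreeMonoid.of none) 1, ∑ α, Finsupp.single (FreeMonoid.of (some α)) 1} ∪
    Set.range (primitivityEquation shuffleOp fun w => Finsupp.single w 1) ∪
    Set.range (fun α : ZMod N => Finsupp.single (FreeMonoid.of (some α)) 1 -
      Finsupp.single (FreeMonoid.of (some (-α))) 1) ∪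
    Set.range (primitivityEquation congruentOp (congruentStarDual N))

theorem cutOut_dmrGroup [Field R] [Algebra ℚ R] (G : Type*) [CommGroup G] [Fintype G] :
    CutOut (groupEquations G) (dmrGroup R G) := by
  intro f
  change (_ ∧ _) ∧ _ ∧ _ ∧ _ ↔ _
  rw [shuffleCoproduct_eq, harmonicCoproduct_eq,
    primitivityEquation_iff shuffleOp (fun w => Finsupp.single w 1) f f (by simp),
    primitivityEquation_iff harmonicOp (starDual G) f _ (linearCombination_starDual G f)]
  simp only [groupEquations, Set.mem_union, or_imp, forall_and, Set.forall_mem_range,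
    Set.mem_insert_iff, Set.mem_singleton_iff, forall_eq, map_sub,
    Finsupp.linearCombination_single, one_smul, and_assoc]

theorem cutOut_dmrCongruent [Field R] [Algebra ℚ R] (N : ℕ) [NeZero N] :
    CutOut (congruentEquations N) (dmrCongruent R N) := by
  intro f
  change (_ ∧ _) ∧ _ ∧ _ ∧ _ ↔ _
  rw [shuffleCoproduct_eq, congruentHarmonicCoproduct_eq,
    primitivityEquation_iff shuffleOp (fun w => Finsupp.single w 1) f f (by simp),
    primitivityEquation_iff congruentOp (congruentStarDual N) f _
      (linearCombination_congruentStarDual N f)]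
  simp only [congruentEquations, Set.mem_union, or_imp, forall_and, Set.forall_mem_range,
    Set.mem_insert_iff, Set.mem_singleton_iff, forall_eq, map_sub, map_sum,
    Finsupp.linearCombination_single, one_smul, and_assoc]

end Rational

/-! ### Galois actions -/

section Galois

variable {N : ℕ} [NeZero N] {K : Type*} [Field K] [Algebra ℚ K] {ζ : K}

theorem galois_rootsOfUnity (hζ : IsPrimitiveRoot ζ N) (σ : K ≃ₐ[ℚ] K) (g : rootsOfUnity N K) :
    σ ((g : Kˣ) : K) = ((g : Kˣ) : K) ^ ((hζ.autToPow ℚ σ : (ZMod N)ˣ) : ZMod N).val := by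
  obtain ⟨m, rfl⟩ := (bijective_toRootsOfUnity_pow hζ).surjective g
  simp only [coe_toRootsOfUnity_pow]
  rw [map_pow, ← hζ.autToPow_spec ℚ σ, ← pow_mul, ← pow_mul, mul_comm]

theorem galois_fourier (hζ : IsPrimitiveRoot ζ N) (σ : K ≃ₐ[ℚ] K) (g : rootsOfUnity N K)
    (α : ZMod N) : σ (fourier N K g α) =
      fourier N K (g ^ ((hζ.autToPow ℚ σ : (ZMod N)ˣ) : ZMod N).val) α := by
  simp only [fourier_apply]
  rw [map_pow, galois_rootsOfUnity hζ]
  simp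

theorem coeffAct_xTransform {I J : Type*} [Fintype I] (σ : K ≃ₐ[ℚ] K) (k : Matrix J I K)
    (f : Series K (XLetter I)) :
    coeffAct σ (xTransform k f) = xTransform (k.map σ) (coeffAct σ f) :=
  funext fun w => map_xTransform (σ : K →+* K) k f w

theorem F_DeltaTilde (hζ : IsPrimitiveRoot ζ N) (σ : K ≃ₐ[ℚ] K) (f : Series K (XLetter (ZMod N))) :
    F hζ (DeltaTilde hζ σ f) = coeffAct σ (F hζ f) := by
  rw [F_eq_xTransform, coeffAct_xTransform]
  change xTransform _ (deltaTilde _ (coeffAct σ f)) = _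
  rw [deltaTilde, rename_eq_xTransform, xTransform_xTransform]
  congr 2
  ext g α
  rw [Matrix.map_apply, galois_fourier hζ, Matrix.mul_apply,
    Finset.sum_eq_single ((hζ.autToPow ℚ σ : (ZMod N)ˣ) * α)]
  · rw [indexMatrix, Matrix.of_apply, if_pos rfl, mul_one, fourier_apply, fourier_apply,
      ← mul_neg, pow_val_mul (coe_pow_card g)]
    simp
  · intro β _ hβ
    rw [indexMatrix, Matrix.of_apply, if_neg hβ.symm, mul_zero]
  · simp

theorem Delta_F (hζ : IsPrimitiveRoot ζ N) (σ : K ≃ₐ[ℚ] K) (f : Series K (XLetter (ZMod N))) :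
    Delta hζ σ (F hζ f) = F hζ (coeffAct σ f) := by
  classical
  have hinj : Function.Injective fun h : rootsOfUnity N K =>
      h ^ ((hζ.autToPow ℚ σ : (ZMod N)ˣ) : ZMod N).val := by
    intro g h hgh
    have h1 := congrArg (fun x : rootsOfUnity N K => ((x : Kˣ) : K)) hgh
    simp only [SubmonoidClass.coe_pow, Units.val_pow_eq_pow_val] at h1
    rw [← galois_rootsOfUnity hζ, ← galois_rootsOfUnity hζ] at h1
    exact Subtype.ext (Units.ext (σ.injective h1))
  change delta _ (coeffAct σ (F hζ f)) = _
  rw [F_eq_xTransform, coeffAct_xTransform, delta, rename_eq_xTransform, xTransform_xTransform]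
  congr 2
  ext g α
  obtain ⟨h, rfl⟩ := (Finite.injective_iff_surjective.1 hinj) g
  rw [Matrix.mul_apply, Finset.sum_eq_single h]
  · rw [Matrix.map_apply, galois_fourier hζ, indexMatrix, Matrix.of_apply, if_pos rfl, one_mul]
  · intro h' _ hh'
    rw [indexMatrix, Matrix.of_apply, if_neg fun h2 => hh' (hinj h2), zero_mul]
  · simp

theorem coeffAct_baseChange {A : Type*} (σ : K ≃ₐ[ℚ] K) (f : Series ℚ A) :
    coeffAct σ (baseChange K A f) = baseChange K A f :=
  funext fun w => σ.commutes (f w)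

theorem baseChange_injective (A : Type*) : Function.Injective (baseChange K A) := fun _ _ h =>
  funext fun w => (algebraMap ℚ K).injective (congrFun h w)

/-- A series that is fixed by the Galois group has rational coefficients. -/
theorem exists_baseChange_eq [FiniteDimensional ℚ K] [IsGalois ℚ K] {A : Type*} (f : Series K A)
    (hf : ∀ σ, coeffAct σ f = f) : ∃ ψ, baseChange K A ψ = f := by
  have h : ∀ w, ∃ q : ℚ, algebraMap ℚ K q = f w := fun w =>
    (IsGalois.mem_range_algebraMap_iff_fixed (f w)).2 fun σ => congrFun (hf σ) w
  choose ψ hψ using h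
  exact ⟨ψ, funext hψ⟩

end Galois

/-! ### Brackets -/

section Brackets

variable {N : ℕ} [NeZero N] {K : Type*} [Field K] {ζ : K}

theorem t_letter_one {G : Type*} [CommGroup G] [Fintype G] (g : G) :
    t K g (letter K (some 1)) = letter K (some g) := by
  classical
  rw [t, rename_eq_xTransform, xTransform, transform_letter, Fintype.sum_option,
    Finset.sum_eq_single g]
  · simp [xRow_some_some, xRow_none_some, indexMatrix]
  · intro h _ hh
    simp [xRow_some_some, indexMatrix, hh.symm]
  · simp

theorem t_comm {G : Type*} [CommGroup G] [Fintype G] (g : G) (f f' : Series K (XLetter G)) :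
    t K g (comm f f') = comm (t K g f) (t K g f') := by
  classical
  rw [t, rename_eq_xTransform, xTransform, transform_comm]

theorem F_sum_letter (hζ : IsPrimitiveRoot ζ N) :
    F hζ (∑ β : ZMod N, letter K (some β)) = (N : K) • letter K (some 1) := by
  classical
  rw [F_eq_xTransform, xTransform, map_sum]
  simp only [transform_letter, Fintype.sum_option, xRow_none_some, xRow_some_some, zero_smul,
    zero_add]
  rw [sum_comm]
  simp only [← sum_smul, sum_fourier]
  rw [Finset.sum_eq_single 1]
  · simp
  · intro g _ hg; simp [hg]
  · simp

theorem comm_smul_left {A : Type*} (c : K) (f g : Series K A) :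
    comm (c • f) g = c • comm f g := by
  simp only [comm, ← mulBilin_apply, map_smul, LinearMap.smul_apply, smul_sub]

/-- The map `𝓕` intertwines the derivations `d̃_ψ` and `d_{𝓕 ψ}`: on the letter `x̃_α`, the sum
`∑_β x̃_β` goes to `N x₁`, and the average over the `t̃_m` goes to the sum over the `t_{ζ^m}`, which
carry the commutator of `x₁` and `𝓕 ψ` to the commutators that define `d_{𝓕 ψ}`. -/
theorem F_dTilde (hζ : IsPrimitiveRoot ζ N) (ψ f : Series K (XLetter (ZMod N))) :
    F hζ (dTilde ζ ψ f) = d (F hζ ψ) (F hζ f) := by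
  have hN : (N : K) ≠ 0 := hζ.neZero'.out
  have hT : ∀ (α : ZMod N) (f : Series K (XLetter (ZMod N))), F hζ (TTilde ζ α f) =
      (N : K)⁻¹ • ∑ g, fourier N K g α • t K g (F hζ f) := by
    intro α f
    rw [← (bijective_toRootsOfUnity_pow hζ).sum_comp]
    simp only [TTilde, LinearMap.smul_apply, LinearMap.sum_apply, map_smul, map_sum, F_tTilde,
      fourier_toRootsOfUnity_pow, one_div]
  have hF := F_eq_xTransform hζ
  rw [dTilde, d, hF, xTransform]
  refine transform_derivation _ _ _ (fun a => ?_) f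
  rw [← xTransform, ← hF]
  cases a with
  | none => simp [Fintype.sum_option, xRow_some_none]
  | some α =>
    simp only [Fintype.sum_option, xRow_none_some, xRow_some_some, zero_smul, zero_add]
    have hc : F hζ (comm (∑ β : ZMod N, letter K (some β)) ψ) =
        (N : K) • comm (letter K (some 1)) (F hζ ψ) := by
      rw [← comm_smul_left, ← F_sum_letter hζ, hF, xTransform, transform_comm]
    rw [hT, hc, smul_sum]
    refine sum_congr rfl fun g _ => ?_
    rw [map_smul, t_comm, t_letter_one, smul_comm (fourier N K g α), inv_smul_smul₀ hN]

theorem F_bracketTilde (hζ : IsPrimitiveRoot ζ N) (f g : Series K (XLetter (ZMod N))) :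
    F hζ (bracketTilde ζ f g) = bracket (F hζ f) (F hζ g) := by
  rw [bracketTilde, map_add, map_sub, F_dTilde, F_dTilde, bracket, F_eq_xTransform, xTransform,
    transform_comm]

/-- The sum of the indices of the letters of a word other than `x̃`. -/
def indexSum {N : ℕ} (w : FreeMonoid (XLetter (ZMod N))) : ZMod N :=
  (w.toList.map fun x => x.getD 0).sum

theorem xTransform_diagonal_pow {z : K} (hz : z ^ N = 1) (m : ZMod N)
    (f : Series K (XLetter (ZMod N))) (w : FreeMonoid (XLetter (ZMod N))) :
    xTransform (Matrix.diagonal fun α => z ^ (m * α).val) f w =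
      z ^ (m * indexSum w).val * f w := by
  induction w using FreeMonoid.inductionOn' generalizing f with
  | one => simp [xTransform_apply_one, indexSum]
  | of_mul x w ih =>
    cases x with
    | none =>
      rw [xTransform_apply_none, ih]
      simp [indexSum, shift_apply]
    | some β =>
      rw [xTransform_apply_some, Finset.sum_eq_single β]
      · have hs : indexSum (FreeMonoid.of (some β) * w) = β + indexSum w := by simp [indexSum]
        rw [Matrix.diagonal_apply_eq, ih, hs, mul_add, pow_val_add hz, mul_assoc, shift_apply]
      · intro γ _ hγ; rw [Matrix.diagonal_apply_ne' _ hγ, zero_mul]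
      · simp

/-- The operator `T̃_α` is the projection to the words whose indices add up to `α`. -/
theorem TTilde_apply (hζ : IsPrimitiveRoot ζ N) (α : ZMod N) (f : Series K (XLetter (ZMod N)))
    (w : FreeMonoid (XLetter (ZMod N))) :
    TTilde ζ α f w = if indexSum w = α then f w else 0 := by
  classical
  have hN : (N : K) ≠ 0 := hζ.neZero'.out
  have hz := hζ.pow_eq_one
  have hterm : ∀ m : ZMod N, ζ ^ (-(m * α)).val * (ζ ^ (m * indexSum w).val * f w) =
      (ζ ^ (indexSum w - α).val) ^ m.val * f w := by
    intro m
    rw [← mul_assoc, ← pow_val_add hz, ← pow_val_mul hz]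
    congr 3
    ring
  have h1 : (ζ ^ (indexSum w - α).val) ^ N = 1 := by
    rw [← pow_mul, mul_comm, pow_mul, hz, one_pow]
  have h2 : ζ ^ (indexSum w - α).val = 1 ↔ indexSum w = α := by
    rw [hζ.pow_eq_one_iff_dvd, ← ZMod.natCast_eq_zero_iff, ZMod.natCast_zmod_val, sub_eq_zero]
  simp only [TTilde, tTilde_eq_xTransform, LinearMap.smul_apply, LinearMap.sum_apply,
    Pi.smul_apply, Finset.sum_apply, smul_eq_mul, xTransform_diagonal_pow hz, hterm]
  rw [← sum_mul, sum_pow_val h1]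
  simp only [h2]
  split_ifs
  · rw [← mul_assoc, one_div_mul_cancel hN, one_mul]
  · simp

variable [Algebra ℚ K]

theorem baseChange_apply {A : Type*} (f : Series ℚ A) (w : FreeMonoid A) :
    baseChange K A f w = algebraMap ℚ K (f w) := rfl

theorem baseChange_mul {A : Type*} (f g : Series ℚ A) :
    baseChange K A (mul f g) = mul (baseChange K A f) (baseChange K A g) := by
  ext w
  simp only [baseChange_apply, mul, map_sum, map_mul]

theorem baseChange_comm {A : Type*} (f g : Series ℚ A) :
    baseChange K A (comm f g) = comm (baseChange K A f) (baseChange K A g) := by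
  rw [comm, map_sub, baseChange_mul, baseChange_mul, comm]

theorem baseChange_letter {A : Type*} (a : A) : baseChange K A (letter ℚ a) = letter K a := by
  ext w
  simp only [baseChange_apply, letter, Pi.single_apply, apply_ite (algebraMap ℚ K), map_one,
    map_zero]

theorem baseChange_derivation {A : Type*} [Fintype A] (D : A → Series ℚ A) (D' : A → Series K A)
    (h : ∀ a, baseChange K A (D a) = D' a) (f : Series ℚ A) :
    baseChange K A (derivation D f) = derivation D' (baseChange K A f) := by
  obtain rfl : (fun a => baseChange K A (D a)) = D' := funext h
  ext w
  simp only [baseChange_apply, derivation, map_sum, map_mul]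

theorem baseChange_t {G : Type*} [CommGroup G] [Fintype G] (g : G) (f : Series ℚ (XLetter G)) :
    baseChange K _ (t ℚ g f) = t K g (baseChange K _ f) := by
  classical
  rw [t, t, rename_eq_xTransform, rename_eq_xTransform]
  ext w
  refine (map_xTransform (algebraMap ℚ K) _ f w).trans ?_
  have h : (indexMatrix ℚ fun h => g * h).map (algebraMap ℚ K) = indexMatrix K fun h => g * h := by
    ext h h'
    simp [indexMatrix, apply_ite (algebraMap ℚ K)]
  rw [h]
  rfl

theorem baseChange_bracket {G : Type*} [CommGroup G] [Fintype G] (f g : Series ℚ (XLetter G)) :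
    baseChange K _ (bracket f g) = bracket (baseChange K _ f) (baseChange K _ g) := by
  have hd : ∀ f g : Series ℚ (XLetter G),
      baseChange K _ (d f g) = d (baseChange K _ f) (baseChange K _ g) := by
    intro f g
    refine baseChange_derivation _ _ (fun a => ?_) g
    cases a with
    | none => exact map_zero _
    | some h => rw [baseChange_comm, baseChange_letter, baseChange_t]
  rw [bracket, map_add, map_sub, hd, hd, baseChange_comm, bracket]

/-- The bracket `⟨·,·⟩~` of rational series is rational, since the operators `T̃_α` are. -/
theorem exists_baseChange_eq_bracketTilde (hζ : IsPrimitiveRoot ζ N)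
    (f g : Series ℚ (XLetter (ZMod N))) :
    ∃ χ, baseChange K _ χ = bracketTilde ζ (baseChange K _ f) (baseChange K _ g) := by
  have hd : ∀ f g : Series ℚ (XLetter (ZMod N)),
      ∃ χ, baseChange K _ χ = dTilde ζ (baseChange K _ f) (baseChange K _ g) := by
    intro f g
    refine ⟨derivation (fun a => match a with
      | none => 0
      | some α => fun w =>
        if indexSum w = α then comm (∑ β : ZMod N, letter ℚ (some β)) f w else 0) g,
      baseChange_derivation _ _ (fun a => ?_) g⟩
    cases a with
    | none => exact map_zero _
    | some α =>
      ext w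
      have hc := congrFun (baseChange_comm (K := K) (∑ β : ZMod N, letter ℚ (some β)) f) w
      simp only [map_sum, baseChange_letter] at hc
      refine Eq.trans ?_ (TTilde_apply hζ α _ w).symm
      rw [← hc]
      exact (apply_ite (algebraMap ℚ K) _ _ _).trans (by rw [map_zero]; rfl)
  obtain ⟨χ₁, h1⟩ := hd f g
  obtain ⟨χ₂, h2⟩ := hd g f
  exact ⟨χ₁ - χ₂ + comm f g, by rw [map_add, map_sub, h1, h2, baseChange_comm, bracketTilde]⟩

end Brackets

/-! ### Galois descent -/

/-- Two injective linear maps with the same image identify their sources. -/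
theorem exists_linearEquiv_of_range_eq {R E V W : Type*} [Ring R] [AddCommGroup E] [Module R E]
    [AddCommGroup V] [Module R V] [AddCommGroup W] [Module R W] (a : V →ₗ[R] E) (b : W →ₗ[R] E)
    (ha : Function.Injective a) (hb : Function.Injective b)
    (h : LinearMap.range a = LinearMap.range b) : ∃ e : V ≃ₗ[R] W, ∀ v, b (e v) = a v := by
  refine ⟨(LinearEquiv.ofInjective a ha).trans
    ((LinearEquiv.ofEq _ _ h).trans (LinearEquiv.ofInjective b hb).symm), fun v => ?_⟩
  have := (LinearEquiv.ofInjective b hb).apply_symm_apply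
    (LinearEquiv.ofEq _ _ h (LinearEquiv.ofInjective a ha v))
  exact congrArg Subtype.val this

section Descent

variable {N : ℕ} [NeZero N] {K : Type*} [Field K] [Algebra ℚ K] {ζ : K}

theorem mem_invariantsMu_iff [FiniteDimensional ℚ K] (hζ : IsPrimitiveRoot ζ N)
    (f : Series K (XLetter (rootsOfUnity N K))) :
    f ∈ invariantsMu hζ ↔ f ∈ dmrGroup K (rootsOfUnity N K) ∧ ∀ σ, Delta hζ σ f = f := by
  change f ∈ completedTensor K _ ∧ _ ↔ _
  rw [completedTensor_eq (cutOut_dmrGroup _) (cutOut_dmrGroup _)]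

theorem mem_invariantsCongruent_iff [FiniteDimensional ℚ K] (hζ : IsPrimitiveRoot ζ N)
    (f : Series K (XLetter (ZMod N))) :
    f ∈ invariantsCongruent hζ ↔ f ∈ dmrCongruent K N ∧ ∀ σ, DeltaTilde hζ σ f = f := by
  change f ∈ completedTensor K _ ∧ _ ↔ _
  rw [completedTensor_eq (cutOut_dmrCongruent N) (cutOut_dmrCongruent N)]

/-- The image under `𝓕` of the `Δ̃`-invariant part is the rational Lie algebra of Racinet. -/
theorem exists_mem_invariantsCongruent_iff [FiniteDimensional ℚ K] [IsGalois ℚ K]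
    (hζ : IsPrimitiveRoot ζ N) (x : Series K (XLetter (rootsOfUnity N K))) :
    (∃ f ∈ invariantsCongruent hζ, F hζ f = x) ↔
      ∃ ψ ∈ dmrGroup ℚ (rootsOfUnity N K), baseChange K _ ψ = x := by
  constructor
  · rintro ⟨f, hf, rfl⟩
    rw [mem_invariantsCongruent_iff] at hf
    obtain ⟨ψ, hψ⟩ := exists_baseChange_eq (F hζ f) fun σ => by rw [← F_DeltaTilde, hf.2]
    refine ⟨ψ, ?_, hψ⟩
    rw [← baseChange_mem_iff (cutOut_dmrGroup _) (cutOut_dmrGroup (R := K) _), hψ,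
      F_mem_dmrGroup_iff]
    exact hf.1
  · rintro ⟨ψ, hψ, rfl⟩
    have hF := F_xTransform_fourierInv hζ (baseChange K _ ψ)
    refine ⟨_, (mem_invariantsCongruent_iff hζ _).2 ⟨?_, fun σ => F_injective hζ ?_⟩, hF⟩
    · rw [← F_mem_dmrGroup_iff hζ, hF, baseChange_mem_iff (cutOut_dmrGroup _) (cutOut_dmrGroup _)]
      exact hψ
    · rw [F_DeltaTilde, hF, coeffAct_baseChange]

/-- The image under `𝓕` of the rational congruent Lie algebra is the `Δ`-invariant part. -/
theorem exists_mem_dmrCongruent_iff [FiniteDimensional ℚ K] [IsGalois ℚ K]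
    (hζ : IsPrimitiveRoot ζ N) (x : Series K (XLetter (rootsOfUnity N K))) :
    (∃ ψ ∈ dmrCongruent ℚ N, F hζ (baseChange K _ ψ) = x) ↔ x ∈ invariantsMu hζ := by
  have hmem : ∀ ψ : Series ℚ (XLetter (ZMod N)),
      F hζ (baseChange K _ ψ) ∈ dmrGroup K (rootsOfUnity N K) ↔ ψ ∈ dmrCongruent ℚ N := by
    intro ψ
    rw [F_mem_dmrGroup_iff,
      baseChange_mem_iff (cutOut_dmrCongruent N) (cutOut_dmrCongruent N)]
  rw [mem_invariantsMu_iff]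
  constructor
  · rintro ⟨ψ, hψ, rfl⟩
    exact ⟨(hmem ψ).2 hψ, fun σ => by rw [Delta_F, coeffAct_baseChange]⟩
  · rintro ⟨hx, hfix⟩
    have hF := F_xTransform_fourierInv hζ x
    obtain ⟨ψ, hψ⟩ := exists_baseChange_eq (xTransform (fourierInv N K) x) fun σ =>
      F_injective hζ (by rw [← Delta_F, hF, hfix])
    refine ⟨ψ, ?_, by rw [hψ, hF]⟩
    rw [← hmem, hψ, hF]
    exact hx

end Descent

end DoubleShuffle

end

theorem mainTheorem2 (N : ℕ) [NeZero N] (hN : 3 ≤ N) (K : Type*) [Field K] [Algebra ℚ K]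
    [IsCyclotomicExtension {N} ℚ K] (ζ : K) (hζ : IsPrimitiveRoot ζ N) :
    (∃ e : DoubleShuffle.invariantsCongruent hζ ≃ₗ[ℚ]
        DoubleShuffle.dmrGroup ℚ (rootsOfUnity N K),
      (∀ f : DoubleShuffle.invariantsCongruent hζ, DoubleShuffle.baseChange K _
          (e f : DoubleShuffle.Series ℚ (DoubleShuffle.XLetter (rootsOfUnity N K))) =
        DoubleShuffle.F hζ f) ∧
      (∀ f g : DoubleShuffle.invariantsCongruent hζ, DoubleShuffle.F hζ (DoubleShuffle.bracketTilde ζ f g) =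
        DoubleShuffle.baseChange K _ (DoubleShuffle.bracket
          (e f : DoubleShuffle.Series ℚ (DoubleShuffle.XLetter (rootsOfUnity N K))) (e g)))) ∧
    (∃ e : DoubleShuffle.dmrCongruent ℚ N ≃ₗ[ℚ] DoubleShuffle.invariantsMu hζ,
      (∀ ψ : DoubleShuffle.dmrCongruent ℚ N, (e ψ : DoubleShuffle.Series K (DoubleShuffle.XLetter (rootsOfUnity N K))) =
        DoubleShuffle.F hζ (DoubleShuffle.baseChange K _ ψ)) ∧
      (∀ ψ₁ ψ₂ : DoubleShuffle.dmrCongruent ℚ N, ∃ χ : DoubleShuffle.Series ℚ (DoubleShuffle.XLetter (ZMod N)),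
        DoubleShuffle.baseChange K _ χ = DoubleShuffle.bracketTilde ζ
          (DoubleShuffle.baseChange K _ ψ₁) (DoubleShuffle.baseChange K _ ψ₂) ∧
        DoubleShuffle.F hζ (DoubleShuffle.baseChange K _ χ) =
          DoubleShuffle.bracket
            (e ψ₁ : DoubleShuffle.Series K (DoubleShuffle.XLetter (rootsOfUnity N K)))
            (e ψ₂))) := by
  open DoubleShuffle in
  have : FiniteDimensional ℚ K := IsCyclotomicExtension.finiteDimensional {N} ℚ K
  have : IsGalois ℚ K := IsCyclotomicExtension.isGalois {N} ℚ K
  constructor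
  · obtain ⟨e, he⟩ := exists_linearEquiv_of_range_eq
      ((F hζ).restrictScalars ℚ ∘ₗ (invariantsCongruent hζ).subtype)
      (baseChange K _ ∘ₗ (dmrGroup ℚ (rootsOfUnity N K)).subtype)
      ((F_injective hζ).comp Subtype.val_injective)
      ((baseChange_injective _).comp Subtype.val_injective) (by
        ext x
        simpa using exists_mem_invariantsCongruent_iff hζ x)
    refine ⟨e, he, fun f g => ?_⟩
    rw [F_bracketTilde, baseChange_bracket]
    exact congrArg₂ bracket (he f).symm (he g).symm
  · obtain ⟨e, he⟩ := exists_linearEquiv_of_range_eq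
      ((F hζ).restrictScalars ℚ ∘ₗ baseChange K _ ∘ₗ (dmrCongruent ℚ N).subtype)
      (invariantsMu hζ).subtype
      ((F_injective hζ).comp ((baseChange_injective _).comp Subtype.val_injective))
      Subtype.val_injective (by
        ext x
        simpa using exists_mem_dmrCongruent_iff hζ x)
    refine ⟨e, he, fun ψ₁ ψ₂ => ?_⟩
    obtain ⟨χ, hχ⟩ := exists_baseChange_eq_bracketTilde hζ (ψ₁ : Series ℚ _) ψ₂
    refine ⟨χ, hχ, ?_⟩
    rw [hχ, F_bracketTilde]
    exact congrArg₂ bracket (he ψ₁).symm (he ψ₂).symm
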